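/- Let $(X,d,\mu)$ be a complete separable metric space with a non-negative Radon (locally finite Borel) measure $\mu$, let $\Omega\subset X$ be open, $\tau>0$, $p\in[1,\infty)$ and $\Omega_\tau:=\Omega\times(0,\tau)$. No doubling condition or Poincaré inequality is assumed. Write $A\Subset B$ if $A\subset B$ is bounded and $\operatorname{dist}(A,B^c)>0$. For an open $U\subset X$, a Borel $g:U\to[0,\infty]$ is a $p$-weak upper gradient of $u:U\to\mathbb R$ if $|u(\gamma_1)-u(\gamma_0)|\le\int_\gamma g\,ds$ for all absolutely continuous curves $\gamma:[0,1]\to U$ outside a family of zero $p$-modulus; it is the minimal one, denoted $g_u$, if it is $p$-integrable and $g\le h$ $\mu$-a.e. for every $p$-integrable $p$-weak upper gradient $h$ of $u$. $N^{1,p}(U)$ is the space of $u\in L^p(U)$ having a $p$-integrable $p$-weak upper gradient, with norm $\left(\|u\|_{L^p(U)}^p+\|g_u\|_{L^p(U)}^p\right)^{1/p}$, modulo functions of zero norm. $u\in N^{1,p}_{\rm loc}(\Omega)$ means that $u\in N^{1,p}(U)$ for every open $U\Subset\Omega$; then $g_u$ denotes the function on $\Omega$ that is the minimal $p$-weak upper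 gradient of $u$ on every such $U$. $f\in L^p_{\rm loc}(0,\tau;N^{1,p}_{\rm loc}(\Omega))$ means that $f(t)\in N^{1,p}_{\rm loc}(\Omega)$ for a.e. $t\in(0,\tau)$ and that, for every open $U\Subset\Omega$ and every $[a,b]\subset(0,\tau)$, the map $t\mapsto f(t)$ is strongly measurable from $[a,b]$ to $N^{1,p}(U)$ with $\int_a^b\|f(t)\|_{N^{1,p}(U)}^p\,dt<\infty$. For a time-dependent function $h$ with $h(t)\in N^{1,p}_{\rm loc}(\Omega)$ for a.e. $t$, $g_h$ is a measurable function of $(x,t)$ with $g_h(\cdot,t)=g_{h(t)}$ for a.e. $t$. Let $\eta\in C^\infty(\mathbb R)$ be non-negative, supported in $[-1,1]$, with $\int\eta=1$, and let $\eta_\varepsilon(s)=\varepsilon^{-1}\eta(s/\varepsilon)$, $\varepsilon>0$. For $f\in L^p_{\rm loc}(0,\tau;N^{1,p}_{\rm loc}(\Omega))$ let $$f_\varepsilon(t)=\int_{-\varepsilon}^{\varepsilon}\eta_\varepsilon(s)f(t-s)\,ds,\qquad t\in(\varepsilon,\tau-\varepsilon),$$ be its time mollification, that is, the element of $N^{1,p}_{\rm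 loc}(\Omega)$ given in each $N^{1,p}(U)$, $U\Subset\Omega$ open, by this Bochner integral. Then $f_\varepsilon$ and the functions $g_{f_\varepsilon-f}$ (for times in $(\varepsilon,\tau-\varepsilon)$) and $g_{f(\cdot-s)-f}$ (for times $t$ with $t,t-s\in(0,\tau)$) exist, and: 1. $g_{f_\varepsilon-f}\to0$ in $L^p_{\rm loc}(\Omega_\tau)$ as $\varepsilon\to0^+$, that is, $\|g_{f_\varepsilon-f}\|_{L^p(K)}\to0$ for every $K\Subset\Omega_\tau$. 2. $g_{f(\cdot-s)-f}\to0$ in $L^p_{\rm loc}(\Omega_\tau)$ as $s\to0$, uniformly in the time range: for every $K\Subset\Omega_\tau$ and $\delta>0$ there is $\sigma>0$ such that $\|g_{f(\cdot-s)-f}\|_{L^p(K\cap(X\times J))}\le\delta$ for all $|s|<\sigma$ and all sets of times $J\subset\mathbb R$. -/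

import Mathlib

open MeasureTheory Filter Topology Set
open scoped ENNReal

noncomputable section

namespace NewtonSobolev

/-- `A ⋐ B`: `A` is a bounded subset of `B` at positive distance from the complement of `B`
(the distance to an empty complement being `+∞`). -/
def WellInside {Y : Type*} [PseudoMetricSpace Y] (A B : Set Y) : Prop :=
  A ⊆ B ∧ Bornology.IsBounded A ∧ ∃ r : ℝ, 0 < r ∧ ∀ x ∈ A, ∀ y ∉ B, r ≤ dist x y

variable {X : Type*} [MetricSpace X]

/-- Absolutely continuous curves `γ : [0,1] → U` (values of `γ` off `[0,1]` are irrelevant). -/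
def IsACCurve (U : Set X) (γ : ℝ → X) : Prop :=
  AbsolutelyContinuousOnInterval γ 0 1 ∧ ∀ t ∈ Icc (0 : ℝ) 1, γ t ∈ U

/-- The metric derivative `|γ'|(t) = lim_{h → 0} d(γ(t+h), γ(t)) / |h|`; for an absolutely
continuous curve the limit exists almost everywhere, elsewhere the upper limit is used. -/
def metricSpeed (γ : ℝ → X) (t : ℝ) : ℝ≥0∞ :=
  limsup (fun h : ℝ => edist (γ (t + h)) (γ t) / ENNReal.ofReal |h|) (𝓝[≠] 0)

/-- The path integral `∫_γ ρ ds = ∫₀¹ ρ(γ(t)) |γ'|(t) dt`. -/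
def curveIntegral (ρ : X → ℝ≥0∞) (γ : ℝ → X) : ℝ≥0∞ :=
  ∫⁻ t in Icc (0 : ℝ) 1, ρ (γ t) * metricSpeed γ t

variable [MeasurableSpace X]

/-- The `p`-modulus, in the metric measure space `(U, d, μ⌞U)`, of a family `Γ` of curves. -/
def modulus (p : ℝ) (μ : Measure X) (U : Set X) (Γ : Set (ℝ → X)) : ℝ≥0∞ :=
  ⨅ (ρ : X → ℝ≥0∞) (_ : Measurable ρ) (_ : ∀ γ ∈ Γ, 1 ≤ curveIntegral ρ γ),
    ∫⁻ x in U, ρ x ^ p ∂μ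

/-- The absolutely continuous curves in `U` along which the upper gradient inequality
`|u(γ(1)) - u(γ(0))| ≤ ∫_γ g ds` fails. -/
def badCurves (U : Set X) (u : X → ℝ) (g : X → ℝ≥0∞) : Set (ℝ → X) :=
  {γ | IsACCurve U γ ∧ ¬ ENNReal.ofReal |u (γ 1) - u (γ 0)| ≤ curveIntegral g γ}

/-- `g` is a `p`-weak upper gradient of `u` in `U`. -/
def IsWeakUpperGradient (p : ℝ) (μ : Measure X) (U : Set X) (u : X → ℝ) (g : X → ℝ≥0∞) : Prop :=
  Measurable g ∧ modulus p μ U (badCurves U u g) = 0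

/-- `g` is a minimal `p`-weak upper gradient of `u` in `U`. -/
def IsMinWeakUpperGradient (p : ℝ) (μ : Measure X) (U : Set X) (u : X → ℝ) (g : X → ℝ≥0∞) :
    Prop :=
  IsWeakUpperGradient p μ U u g ∧ ∫⁻ x in U, g x ^ p ∂μ < ∞ ∧
    ∀ h : X → ℝ≥0∞, IsWeakUpperGradient p μ U u h → ∫⁻ x in U, h x ^ p ∂μ < ∞ →
      ∀ᵐ x ∂(μ.restrict U), g x ≤ h x

/-- The Dirichlet seminorm: the least `L^p(U)` norm of a `p`-weak upper gradient of `u` in `U`. -/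
def gradNorm (p : ℝ) (μ : Measure X) (U : Set X) (u : X → ℝ) : ℝ≥0∞ :=
  ⨅ (g : X → ℝ≥0∞) (_ : IsWeakUpperGradient p μ U u g), eLpNorm g (ENNReal.ofReal p) (μ.restrict U)

/-- `u|_U` is a `p`-integrable function with a `p`-integrable `p`-weak upper gradient in `U`. -/
def MemNewton (p : ℝ) (μ : Measure X) (U : Set X) (u : X → ℝ) : Prop :=
  MemLp u (ENNReal.ofReal p) (μ.restrict U) ∧
    ∃ g : X → ℝ≥0∞, IsWeakUpperGradient p μ U u g ∧ ∫⁻ x in U, g x ^ p ∂μ < ∞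

/-- `(‖u‖_{L^p(U)}^p + ‖g_u‖_{L^p(U)}^p)^{1/p}`. -/
def newtonENorm (p : ℝ) (μ : Measure X) (U : Set X) (u : X → ℝ) : ℝ≥0∞ :=
  (eLpNorm u (ENNReal.ofReal p) (μ.restrict U) ^ p + gradNorm p μ U u ^ p) ^ (1 / p)

section basic

variable {p : ℝ} {μ : Measure X} {U : Set X}

lemma curveIntegral_mono {ρ σ : X → ℝ≥0∞} (h : ∀ x, ρ x ≤ σ x) (γ : ℝ → X) :
    curveIntegral ρ γ ≤ curveIntegral σ γ :=
  lintegral_mono fun t => mul_le_mul_left (h (γ t)) _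

lemma modulus_mono {Γ Γ' : Set (ℝ → X)} (h : Γ ⊆ Γ') : modulus p μ U Γ ≤ modulus p μ U Γ' := by
  refine le_iInf fun ρ => le_iInf fun hρ => le_iInf fun h1 => ?_
  exact iInf_le_of_le ρ (iInf_le_of_le hρ (iInf_le_of_le (fun γ hγ => h1 γ (h hγ)) le_rfl))

lemma modulus_union_le (hp : 1 ≤ p) (Γ Γ' : Set (ℝ → X)) :
    modulus p μ U (Γ ∪ Γ') ≤ modulus p μ U Γ + modulus p μ U Γ' := by
  unfold modulus
  simp only [ENNReal.iInf_add, ENNReal.add_iInf]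
  refine le_iInf fun ρ => le_iInf fun hρ => le_iInf fun h1 => ?_
  refine le_iInf fun σ => le_iInf fun hσ => le_iInf fun h2 => ?_
  refine iInf_le_of_le (fun x => max (σ x) (ρ x)) (iInf_le_of_le (hσ.max hρ) (iInf_le_of_le ?_ ?_))
  · rintro γ (hγ | hγ)
    · first
      | exact (h1 γ hγ).trans (curveIntegral_mono (fun x => le_max_right _ _) γ)
      | exact (h2 γ hγ).trans (curveIntegral_mono (fun x => le_max_left _ _) γ)
    · first
      | exact (h2 γ hγ).trans (curveIntegral_mono (fun x => le_max_left _ _) γ)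
      | exact (h1 γ hγ).trans (curveIntegral_mono (fun x => le_max_right _ _) γ)
  · rw [← lintegral_add_left (by fun_prop)]
    refine lintegral_mono fun x => ?_
    rcases le_total (σ x) (ρ x) with h | h
    · simp [max_eq_right h]
    · simp [max_eq_left h]

lemma IsWeakUpperGradient.add (hp : 1 ≤ p) {u v : X → ℝ} {g h : X → ℝ≥0∞}
    (hu : IsWeakUpperGradient p μ U u g) (hv : IsWeakUpperGradient p μ U v h) :
    IsWeakUpperGradient p μ U (u + v) (g + h) := by
  refine ⟨hu.1.add hv.1, le_antisymm ?_ bot_le⟩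
  have hsub : badCurves U (u + v) (g + h) ⊆ badCurves U u g ∪ badCurves U v h := by
    rintro γ ⟨hγ, hb⟩
    by_contra hcon
    simp only [badCurves, mem_union, mem_ofPred_eq, hγ, true_and, not_or, not_not] at hcon
    apply hb
    have e : (u + v) (γ 1) - (u + v) (γ 0) = (u (γ 1) - u (γ 0)) + (v (γ 1) - v (γ 0)) := by
      simp only [Pi.add_apply]; ring
    rw [e]
    calc _ ≤ ENNReal.ofReal (|u (γ 1) - u (γ 0)| + |v (γ 1) - v (γ 0)|) :=
          ENNReal.ofReal_le_ofReal (abs_add_le _ _)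
      _ = _ := ENNReal.ofReal_add (abs_nonneg _) (abs_nonneg _)
      _ ≤ _ := add_le_add hcon.1 hcon.2
      _ ≤ _ := by
          refine (le_lintegral_add _ _).trans (le_of_eq ?_)
          simp only [curveIntegral, Pi.add_apply, add_mul]
  calc _ ≤ _ := modulus_mono hsub
    _ ≤ _ := modulus_union_le hp _ _
    _ = 0 := by rw [hu.2, hv.2, add_zero]

lemma IsWeakUpperGradient.smul (c : ℝ) {u : X → ℝ} {g : X → ℝ≥0∞}
    (hu : IsWeakUpperGradient p μ U u g) :
    IsWeakUpperGradient p μ U (c • u) (fun x => ENNReal.ofReal |c| * g x) := by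
  refine ⟨hu.1.const_mul _, le_antisymm ?_ bot_le⟩
  rw [← hu.2]
  refine modulus_mono ?_
  rintro γ ⟨hγ, hb⟩
  refine ⟨hγ, fun h => hb ?_⟩
  have e : (c • u) (γ 1) - (c • u) (γ 0) = c * (u (γ 1) - u (γ 0)) := by
    simp only [Pi.smul_apply, smul_eq_mul]; ring
  rw [e, abs_mul, ENNReal.ofReal_mul (abs_nonneg _)]
  simp only [curveIntegral, mul_assoc]
  rw [lintegral_const_mul' _ _ ENNReal.ofReal_ne_top]
  exact mul_le_mul_right h _

lemma isWeakUpperGradient_zero (hp : 1 ≤ p) : IsWeakUpperGradient p μ U (0 : X → ℝ) 0 := by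
  refine ⟨measurable_const, le_antisymm ?_ bot_le⟩
  refine iInf_le_of_le 0 (iInf_le_of_le measurable_const (iInf_le_of_le ?_ ?_))
  · rintro γ ⟨-, h⟩
    simp at h
  · simp [ENNReal.zero_rpow_of_pos (zero_lt_one.trans_le hp)]

lemma eLpNorm_lt_top_iff_lintegral (hp : 1 ≤ p) (g : X → ℝ≥0∞) :
    eLpNorm g (ENNReal.ofReal p) (μ.restrict U) < ∞ ↔ ∫⁻ x in U, g x ^ p ∂μ < ∞ := by
  have hp0 : 0 < p := zero_lt_one.trans_le hp
  rw [eLpNorm_lt_top_iff_lintegral_rpow_enorm_lt_top (by simpa using hp0) ENNReal.ofReal_ne_top,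
    ENNReal.toReal_ofReal hp0.le]
  simp

lemma gradNorm_lt_top_iff (hp : 1 ≤ p) (u : X → ℝ) : gradNorm p μ U u < ∞ ↔
    ∃ g : X → ℝ≥0∞, IsWeakUpperGradient p μ U u g ∧ ∫⁻ x in U, g x ^ p ∂μ < ∞ := by
  simp only [gradNorm, iInf_lt_iff, exists_prop, eLpNorm_lt_top_iff_lintegral hp]

lemma gradNorm_add_le (hp : 1 ≤ p) (u v : X → ℝ) :
    gradNorm p μ U (u + v) ≤ gradNorm p μ U u + gradNorm p μ U v := by
  conv_rhs => unfold gradNorm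
  simp only [ENNReal.iInf_add, ENNReal.add_iInf]
  refine le_iInf fun g => le_iInf fun hg => le_iInf fun h => le_iInf fun hh => ?_
  first
  | exact (iInf₂_le _ (hg.add hp hh)).trans (eLpNorm_add_le hg.1.aestronglyMeasurable
      hh.1.aestronglyMeasurable (by simpa using hp))
  | (rw [add_comm u v, add_comm (eLpNorm _ _ _)]
     exact (iInf₂_le _ (hg.add hp hh)).trans (eLpNorm_add_le hg.1.aestronglyMeasurable
      hh.1.aestronglyMeasurable (by simpa using hp)))

lemma gradNorm_smul_le (hp : 1 ≤ p) (c : ℝ) (u : X → ℝ) :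
    gradNorm p μ U (c • u) ≤ ENNReal.ofReal |c| * gradNorm p μ U u := by
  have hp0 : 0 < p := zero_lt_one.trans_le hp
  rcases eq_or_ne c 0 with rfl | hc
  · rw [zero_smul]
    refine (iInf₂_le _ (isWeakUpperGradient_zero hp)).trans ?_
    rw [eLpNorm_zero]
    exact bot_le
  · have hc0 : ENNReal.ofReal |c| ≠ 0 := by simpa using hc
    conv_rhs => unfold gradNorm
    simp only [ENNReal.mul_iInf_of_ne hc0 ENNReal.ofReal_ne_top]
    refine le_iInf fun g => le_iInf fun hg => (iInf₂_le _ (hg.smul c)).trans ?_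
    have hq0 : ENNReal.ofReal p ≠ 0 := by simpa using hp0
    rw [eLpNorm_eq_lintegral_rpow_enorm_toReal hq0 ENNReal.ofReal_ne_top,
      eLpNorm_eq_lintegral_rpow_enorm_toReal hq0 ENNReal.ofReal_ne_top,
      ENNReal.toReal_ofReal hp0.le]
    simp only [enorm_eq_self, ENNReal.mul_rpow_of_nonneg _ _ hp0.le]
    rw [lintegral_const_mul' _ _ (ENNReal.rpow_ne_top_of_nonneg hp0.le ENNReal.ofReal_ne_top),
      ENNReal.mul_rpow_of_nonneg _ _ (by positivity), ← ENNReal.rpow_mul,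
      mul_one_div_cancel hp0.ne', ENNReal.rpow_one]

lemma newtonENorm_add_le (hp : 1 ≤ p) {u v : X → ℝ} (hu : MemNewton p μ U u)
    (hv : MemNewton p μ U v) :
    newtonENorm p μ U (u + v) ≤ newtonENorm p μ U u + newtonENorm p μ U v := by
  have hp0 : 0 < p := zero_lt_one.trans_le hp
  have key := ENNReal.Lp_add_le (Finset.univ : Finset (Fin 2))
    ![eLpNorm u (ENNReal.ofReal p) (μ.restrict U), gradNorm p μ U u]
    ![eLpNorm v (ENNReal.ofReal p) (μ.restrict U), gradNorm p μ U v] hp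
  simp only [Fin.sum_univ_two, Matrix.cons_val_zero, Matrix.cons_val_one] at key
  refine le_trans ?_ key
  unfold newtonENorm
  gcongr
  · exact eLpNorm_add_le hu.1.1 hv.1.1 (by simpa using hp)
  · exact gradNorm_add_le hp u v

lemma newtonENorm_smul_le (hp : 1 ≤ p) (c : ℝ) (u : X → ℝ) :
    newtonENorm p μ U (c • u) ≤ ENNReal.ofReal |c| * newtonENorm p μ U u := by
  have hp0 : 0 < p := zero_lt_one.trans_le hp
  have h1 : eLpNorm (c • u) (ENNReal.ofReal p) (μ.restrict U) =
      ENNReal.ofReal |c| * eLpNorm u (ENNReal.ofReal p) (μ.restrict U) := by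
    rw [eLpNorm_const_smul, ← ofReal_norm, Real.norm_eq_abs]
  calc newtonENorm p μ U (c • u)
      ≤ ((ENNReal.ofReal |c| * eLpNorm u (ENNReal.ofReal p) (μ.restrict U)) ^ p +
          (ENNReal.ofReal |c| * gradNorm p μ U u) ^ p) ^ (1 / p) := by
        unfold newtonENorm
        rw [h1]
        gcongr
        exact gradNorm_smul_le hp c u
    _ = _ := by
        rw [ENNReal.mul_rpow_of_nonneg _ _ hp0.le, ENNReal.mul_rpow_of_nonneg _ _ hp0.le,
          ← mul_add, ENNReal.mul_rpow_of_nonneg _ _ (by positivity), ← ENNReal.rpow_mul,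
          mul_one_div_cancel hp0.ne', ENNReal.rpow_one]
        rfl

lemma MemNewton.newtonENorm_ne_top (hp : 1 ≤ p) {u : X → ℝ} (hu : MemNewton p μ U u) :
    newtonENorm p μ U u ≠ ∞ := by
  have hp0 : 0 < p := zero_lt_one.trans_le hp
  refine ENNReal.rpow_ne_top_of_nonneg (by positivity) (ENNReal.add_ne_top.2 ⟨?_, ?_⟩)
  · exact ENNReal.rpow_ne_top_of_nonneg hp0.le hu.1.2.ne
  · exact ENNReal.rpow_ne_top_of_nonneg hp0.le ((gradNorm_lt_top_iff hp u).2 hu.2).ne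

lemma MemNewton.add (hp : 1 ≤ p) {u v : X → ℝ} (hu : MemNewton p μ U u)
    (hv : MemNewton p μ U v) : MemNewton p μ U (u + v) := by
  refine ⟨hu.1.add hv.1, (gradNorm_lt_top_iff hp _).1 ((gradNorm_add_le hp u v).trans_lt ?_)⟩
  exact ENNReal.add_lt_top.2 ⟨(gradNorm_lt_top_iff hp u).2 hu.2, (gradNorm_lt_top_iff hp v).2 hv.2⟩

lemma MemNewton.smul (hp : 1 ≤ p) (c : ℝ) {u : X → ℝ} (hu : MemNewton p μ U u) :
    MemNewton p μ U (c • u) := by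
  refine ⟨hu.1.const_smul c, (gradNorm_lt_top_iff hp _).1 ((gradNorm_smul_le hp c u).trans_lt ?_)⟩
  exact ENNReal.mul_lt_top ENNReal.ofReal_lt_top ((gradNorm_lt_top_iff hp u).2 hu.2)

lemma memNewton_zero (hp : 1 ≤ p) : MemNewton p μ U (0 : X → ℝ) :=
  ⟨MemLp.zero, 0, isWeakUpperGradient_zero hp, by
    simp [ENNReal.zero_rpow_of_pos (zero_lt_one.trans_le hp)]⟩

end basic

/-- The vector space of functions underlying `N^{1,p}(U)`, before passing to the quotient.
Functions are defined on all of `X`, but only their values on `U` enter. -/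
def preNewtonSubmodule (p : ℝ) [hp : Fact (1 ≤ p)] (μ : Measure X) (U : Set X) :
    Submodule ℝ (X → ℝ) where
  carrier := {u | MemNewton p μ U u}
  add_mem' hu hv := MemNewton.add hp.out hu hv
  zero_mem' := memNewton_zero hp.out
  smul_mem' c _ hu := MemNewton.smul hp.out c hu

/-- `Ñ^{1,p}(U)`, to be equipped with its seminorm. -/
def PreNewton (p : ℝ) [Fact (1 ≤ p)] (μ : Measure X) (U : Set X) : Type _ :=
  ↥(preNewtonSubmodule p μ U)

section norm

variable (p : ℝ) [hp : Fact (1 ≤ p)] (μ : Measure X) (U : Set X)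

instance : AddCommGroup (PreNewton p μ U) :=
  inferInstanceAs (AddCommGroup ↥(preNewtonSubmodule p μ U))

instance : Module ℝ (PreNewton p μ U) :=
  inferInstanceAs (Module ℝ ↥(preNewtonSubmodule p μ U))

/-- The seminorm of `Ñ^{1,p}(U)`. -/
def newtonSeminorm : Seminorm ℝ (PreNewton p μ U) :=
  Seminorm.ofSMulLE (fun u => (newtonENorm p μ U u.1).toReal)
    (by
      have h := newtonENorm_smul_le (μ := μ) (U := U) hp.out 0 (0 : X → ℝ)
      simp only [zero_smul, abs_zero, ENNReal.ofReal_zero, zero_mul, nonpos_iff_eq_zero] at h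
      change (newtonENorm p μ U (0 : X → ℝ)).toReal = 0
      rw [h, ENNReal.toReal_zero])
    (fun u v => by
      have hu := MemNewton.newtonENorm_ne_top hp.out u.2
      have hv := MemNewton.newtonENorm_ne_top hp.out v.2
      rw [← ENNReal.toReal_add hu hv]
      exact ENNReal.toReal_mono (ENNReal.add_ne_top.2 ⟨hu, hv⟩)
        (newtonENorm_add_le hp.out u.2 v.2))
    (fun c u => by
      have hu := MemNewton.newtonENorm_ne_top hp.out u.2
      have h := ENNReal.toReal_mono (ENNReal.mul_ne_top ENNReal.ofReal_ne_top hu)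
        (newtonENorm_smul_le (μ := μ) (U := U) hp.out c u.1)
      rwa [ENNReal.toReal_mul, ENNReal.toReal_ofReal (abs_nonneg c), ← Real.norm_eq_abs] at h)

instance : SeminormedAddCommGroup (PreNewton p μ U) :=
  (newtonSeminorm p μ U).toAddGroupSeminorm.toSeminormedAddCommGroup

instance : NormedSpace ℝ (PreNewton p μ U) where
  norm_smul_le c u := (map_smul_eq_mul (newtonSeminorm p μ U) c u).le

/-- The Newton-Sobolev space `N^{1,p}(U)`: the quotient of `Ñ^{1,p}(U)` by the functions of zero
seminorm, with the quotient norm. -/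
abbrev Newton : Type _ := SeparationQuotient (PreNewton p μ U)

open Classical in
/-- The class in `N^{1,p}(U)` of a function `u` with `u|_U ∈ Ñ^{1,p}(U)` (and `0` otherwise). -/
def toNewton (u : X → ℝ) : Newton p μ U :=
  if h : MemNewton p μ U u then SeparationQuotient.mk (⟨u, h⟩ : PreNewton p μ U) else 0

end norm

/-- `u ∈ N^{1,p}_loc(Ω)`: `u ∈ N^{1,p}(U)` for all open `U ⋐ Ω`. -/
def MemNewtonLoc (p : ℝ) (μ : Measure X) (Ω : Set X) (u : X → ℝ) : Prop :=
  ∀ U : Set X, IsOpen U → WellInside U Ω → MemNewton p μ U u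

/-- `g` is the minimal `p`-weak upper gradient of `u ∈ N^{1,p}_loc(Ω)`, that is, on every open
`U ⋐ Ω`. -/
def IsMinWeakUpperGradientLoc (p : ℝ) (μ : Measure X) (Ω : Set X) (u : X → ℝ) (g : X → ℝ≥0∞) :
    Prop :=
  ∀ U : Set X, IsOpen U → WellInside U Ω → IsMinWeakUpperGradient p μ U u g

/-- `f ∈ L^p_loc(0,τ; N^{1,p}_loc(Ω))`: for all open `U ⋐ Ω` and `[a,b] ⊂ (0,τ)`, the map
`t ↦ f(t)` is strongly measurable from `[a,b]` to `N^{1,p}(U)`, with `p`-integrable norm. Here `f`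
is given by representatives `f t : X → ℝ`, of which only the values on `Ω` enter. -/
def MemParabolicLoc (p : ℝ) [Fact (1 ≤ p)] (μ : Measure X) (Ω : Set X) (τ : ℝ)
    (f : ℝ → X → ℝ) : Prop :=
  (∀ᵐ t ∂(volume.restrict (Ioo 0 τ)), MemNewtonLoc p μ Ω (f t)) ∧
    ∀ U : Set X, IsOpen U → WellInside U Ω → ∀ a b : ℝ, 0 < a → b < τ →
      MemLp (fun t => toNewton p μ U (f t)) (ENNReal.ofReal p) (volume.restrict (Icc a b))

/-- Standard mollifiers on the real line. -/
structure IsMollifier (η : ℝ → ℝ) : Prop where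
  smooth : ContDiff ℝ (⊤ : ℕ∞) η
  nonneg : ∀ s, 0 ≤ η s
  support : tsupport η ⊆ Icc (-1) 1
  integral_eq_one : ∫ s, η s = 1

/-- `F` is the time mollification `f_ε`: for all `t` with `[t-ε, t+ε] ⊂ (0,τ)`, the function
`F t ∈ N^{1,p}_loc(Ω)` is `∫_{-ε}^{ε} η_ε(s) f(t-s) ds` with `η_ε(s) = ε⁻¹ η(s/ε)`, a Bochner
integral in `N^{1,p}(U)` for each open `U ⋐ Ω`. -/
def IsTimeMollification (p : ℝ) [Fact (1 ≤ p)] (μ : Measure X) (Ω : Set X) (τ : ℝ)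
    (η : ℝ → ℝ) (ε : ℝ) (f F : ℝ → X → ℝ) : Prop :=
  ∀ t ∈ Ioo ε (τ - ε), MemNewtonLoc p μ Ω (F t) ∧
    ∀ U : Set X, IsOpen U → WellInside U Ω →
      toNewton p μ U (F t) = ∫ s in (-ε)..ε, (ε⁻¹ * η (s / ε)) • toNewton p μ U (f (t - s))

/-- `G` is the parabolic minimal `p`-weak upper gradient of `h` in `Ω × J`: a measurable function
of `(x,t)` with `G(·,t)` the minimal `p`-weak upper gradient of `h(t)` for almost every `t`. -/
def IsParabolicMinUpperGradient (p : ℝ) (μ : Measure X) (Ω : Set X) (J : Set ℝ)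
    (h : ℝ → X → ℝ) (G : X × ℝ → ℝ≥0∞) : Prop :=
  Measurable G ∧ ∀ᵐ t ∂(volume.restrict J),
    IsMinWeakUpperGradientLoc p μ Ω (h t) (fun x => G (x, t))

end NewtonSobolev

end

/-! Both convergences are statements about norms. On an open U ⋐ Ω the L^p(U) norm of the minimal
gradient g_h is at most the N^{1,p}(U) norm of h. By Fubini, the norms over K ⊆ U × [a,b] are then
bounded by the distance of f_ε, respectively f(· - s), from f in L^p(a,b; N^{1,p}(U))
(`IsParabolicMinUpperGradient.eLpNorm_rpow_le`); linearity of u ↦ g_u plays no role. In L^p(ℝ; E)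
with E a Banach space, translations are continuous (`tendsto_lintegral_translation_sub`). A
mollification is an average of translations, so Jensen and Fubini give its convergence
(`IsMollifier.tendsto_lintegral_mollify_sub`).

The bulk of the work is existence, with neither doubling nor a Poincaré inequality.

Minimal gradients come from the direct method (`exists_isMinWeakUpperGradient`). The minimum of two
weak upper gradients is again one, because along almost every curve γ the function u ∘ γ is
absolutely continuous with derivative controlled by both. The same argument, pasted over an open
subset (`IsWeakUpperGradient.of_min_le`), shows that minimality passes to open subsets, so the
gradients on an exhaustion of Ω fit together.

Completeness rests on `exists_newton_limit`: a sequence with summable increments has a pointwise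
limit whose gradient is controlled by the sum of the gradients. Almost every curve with distinct
endpoints leaves the null set of divergence, and finiteness of the summed curve integrals carries
convergence from one point of the curve to all of it. The same lemma glues compatible classes on an
exhaustion into one function on Ω, which produces f_ε.

Joint measurability of g_{h(t)}(x) follows by approximating h with maps taking countably many values
in N^{1,p}(U): by sublinearity |g_u - g_v| ≤ g_{u-v}, so the gradients of the approximants converge
almost everywhere. -/

noncomputable section

namespace NewtonSobolev

/-! ### Absolutely continuous functions on an interval -/

section realLine

lemma absolutelyContinuousOnInterval_of_dist_le {Y Z : Type*} [PseudoMetricSpace Y]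
    [PseudoMetricSpace Z] {φ : ℝ → Y} {ψ : ℝ → Z} {a b : ℝ}
    (hψ : AbsolutelyContinuousOnInterval ψ a b)
    (h : ∀ x ∈ uIcc a b, ∀ y ∈ uIcc a b, dist (φ x) (φ y) ≤ dist (ψ x) (ψ y)) :
    AbsolutelyContinuousOnInterval φ a b := by
  rw [absolutelyContinuousOnInterval_iff] at hψ ⊢
  intro ε hε
  obtain ⟨δ, hδ, H⟩ := hψ ε hε
  refine ⟨δ, hδ, fun E hE hl => lt_of_le_of_lt ?_ (H E hE hl)⟩
  exact Finset.sum_le_sum fun i hi => h _ (hE.1 i hi).1 _ (hE.1 i hi).2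

lemma absolutelyContinuousOnInterval_comp_affine {Y : Type*} [PseudoMetricSpace Y]
    {γ : ℝ → Y} {a b : ℝ} (hab : a ≤ b) (hγ : AbsolutelyContinuousOnInterval γ a b) :
    AbsolutelyContinuousOnInterval (fun t => γ (a + (b - a) * t)) 0 1 := by
  rcases hab.eq_or_lt with rfl | hlt
  · have : LipschitzOnWith 0 (fun t : ℝ => γ (a + (a - a) * t)) (uIcc 0 1) := by
      intro x _ y _
      simp
    exact this.absolutelyContinuousOnInterval
  rw [absolutelyContinuousOnInterval_iff] at hγ ⊢
  have hc : 0 < b - a := sub_pos.2 hlt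
  intro ε hε
  obtain ⟨δ, hδ, H⟩ := hγ ε hε
  refine ⟨δ / (b - a), by positivity, fun E hE hl => ?_⟩
  refine H (E.1, fun i => (a + (b - a) * (E.2 i).1, a + (b - a) * (E.2 i).2)) ⟨?_, ?_⟩ ?_
  · intro i hi
    have := hE.1 i hi
    simp only [uIcc_of_le hab, uIcc_of_le zero_le_one, mem_Icc] at this ⊢
    constructor <;> constructor <;> nlinarith
  · intro i hi j hj hij
    have := hE.2 hi hj hij
    simp only [Function.onFun] at this ⊢
    rw [Set.disjoint_left] at this ⊢
    intro x hx hx'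
    have key : ∀ y z : ℝ, x ∈ uIoc (a + (b - a) * y) (a + (b - a) * z) →
        (x - a) / (b - a) ∈ uIoc y z := by
      intro y z h
      rw [mem_uIoc] at h ⊢
      simp only [lt_div_iff₀ hc, div_le_iff₀ hc]
      rcases h with h | h
      · left; constructor <;> nlinarith
      · right; constructor <;> nlinarith
    exact this (key _ _ hx) (key _ _ hx')
  · rw [lt_div_iff₀ hc] at hl
    refine lt_of_le_of_lt (le_of_eq ?_) hl
    rw [Finset.sum_mul]
    refine Finset.sum_congr rfl fun i _ => ?_
    simp only [Real.dist_eq, add_sub_add_left_eq_sub, ← mul_sub, abs_mul, abs_of_pos hc]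
    ring

lemma ofReal_abs_sub_le_lintegral_deriv {φ : ℝ → ℝ} {a b : ℝ} (hab : a ≤ b)
    (hφ : AbsolutelyContinuousOnInterval φ a b) :
    ENNReal.ofReal |φ b - φ a| ≤ ∫⁻ t in Icc a b, ‖deriv φ t‖ₑ := by
  rw [← hφ.integral_deriv_eq_sub, intervalIntegral.integral_of_le hab,
    ← integral_Icc_eq_integral_Ioc, ← Real.norm_eq_abs, ofReal_norm]
  exact enorm_integral_le_lintegral_enorm _

lemma lintegral_Icc_eq_ofReal_integral {H : ℝ → ℝ≥0∞} {a b : ℝ} (ha : 0 ≤ a) (hab : a ≤ b)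
    (hb : b ≤ 1) (hH : AEMeasurable H (volume.restrict (Icc 0 1)))
    (hfin : ∫⁻ t in Icc (0 : ℝ) 1, H t ≠ ∞) :
    ∫⁻ t in Icc a b, H t =
      ENNReal.ofReal ((∫ t in (0 : ℝ)..b, (H t).toReal) - ∫ t in (0 : ℝ)..a, (H t).toReal) := by
  have hsub : Icc a b ⊆ Icc (0 : ℝ) 1 := Icc_subset_Icc ha hb
  have hint : IntegrableOn (fun t => (H t).toReal) (Icc 0 1) :=
    integrable_toReal_of_lintegral_ne_top hH hfin
  have hii : ∀ c d : ℝ, c ∈ Icc (0 : ℝ) 1 → d ∈ Icc (0 : ℝ) 1 →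
      IntervalIntegrable (fun t => (H t).toReal) volume c d := fun c d hc hd =>
    (hint.mono_set (ordConnected_Icc.uIcc_subset hc hd)).intervalIntegrable
  rw [intervalIntegral.integral_interval_sub_left (hii _ _ (by simp) ⟨ha.trans hab, hb⟩)
    (hii _ _ (by simp) ⟨ha, hab.trans hb⟩), intervalIntegral.integral_of_le hab,
    ← integral_Icc_eq_integral_Ioc]
  have hm : AEMeasurable H (volume.restrict (Icc a b)) := hH.mono_set hsub
  have hf : ∫⁻ t in Icc a b, H t ≠ ∞ := ne_top_of_le_ne_top hfin (lintegral_mono_set hsub)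
  rw [integral_toReal hm (ae_lt_top' hm hf), ENNReal.ofReal_toReal hf]

/-- The increments are dominated by those of the primitive of `G`, which is absolutely continuous.
-/
lemma absolutelyContinuousOnInterval_of_le_lintegral {φ : ℝ → ℝ} {G : ℝ → ℝ≥0∞}
    (hG : AEMeasurable G (volume.restrict (Icc 0 1))) (hfin : ∫⁻ t in Icc (0 : ℝ) 1, G t ≠ ∞)
    (h : ∀ a b, 0 ≤ a → a ≤ b → b ≤ 1 → ENNReal.ofReal |φ b - φ a| ≤ ∫⁻ t in Icc a b, G t) :
    AbsolutelyContinuousOnInterval φ 0 1 := by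
  have hint : IntegrableOn (fun t => (G t).toReal) (Icc 0 1) :=
    integrable_toReal_of_lintegral_ne_top hG hfin
  have hii : IntervalIntegrable (fun t => (G t).toReal) volume 0 1 :=
    (hint.mono_set (by rw [uIcc_of_le (zero_le_one' ℝ)])).intervalIntegrable
  refine absolutelyContinuousOnInterval_of_dist_le
    (hii.absolutelyContinuousOnInterval_intervalIntegral (c := 0) (by simp)) ?_
  have key : ∀ x y, 0 ≤ x → x ≤ y → y ≤ 1 → |φ y - φ x| ≤
      |(∫ t in (0 : ℝ)..y, (G t).toReal) - ∫ t in (0 : ℝ)..x, (G t).toReal| := by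
    intro x y hx hxy hy
    have h1 := h x y hx hxy hy
    rw [lintegral_Icc_eq_ofReal_integral hx hxy hy hG hfin] at h1
    rw [← ENNReal.ofReal_le_ofReal_iff (abs_nonneg _)]
    exact h1.trans (ENNReal.ofReal_le_ofReal (le_abs_self _))
  intro x hx y hy
  rw [uIcc_of_le zero_le_one] at hx hy
  rcases le_total x y with hxy | hxy
  · rw [dist_comm, dist_comm (∫ t in (0 : ℝ)..x, (G t).toReal)]
    exact key x y hx.1 hxy hy.2
  · exact key y x hy.1 hxy hx.2

/-- Lebesgue differentiation of the primitive of `H`. Only intervals to the right of `t` are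
required: a curve at a point of an open set stays there for a short time, and a gradient defined on
that set controls it only on this stretch. -/
lemma ae_enorm_deriv_le {φ : ℝ → ℝ} (hφ : AbsolutelyContinuousOnInterval φ 0 1) {H : ℝ → ℝ≥0∞}
    (hH : AEMeasurable H (volume.restrict (Icc 0 1))) (hfin : ∫⁻ t in Icc (0 : ℝ) 1, H t ≠ ∞) :
    ∀ᵐ t ∂(volume.restrict (Icc (0 : ℝ) 1)),
      (∀ᶠ b in 𝓝[>] t, ENNReal.ofReal |φ b - φ t| ≤ ∫⁻ s in Icc t b, H s) →
        ‖deriv φ t‖ₑ ≤ H t := by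
  have hint : IntegrableOn (fun t => (H t).toReal) (Icc 0 1) :=
    integrable_toReal_of_lintegral_ne_top hH hfin
  have hii : IntervalIntegrable (fun t => (H t).toReal) volume 0 1 :=
    (hint.mono_set (by rw [uIcc_of_le (zero_le_one' ℝ)])).intervalIntegrable
  rw [ae_restrict_iff' measurableSet_Icc]
  have h1 : ∀ᵐ t : ℝ, t ≠ 1 := by simp [ae_iff]
  filter_upwards [hφ.ae_differentiableAt, hii.ae_hasDerivAt_integral, h1] with t hd hi ht1 ht hb
  rw [uIcc_of_le zero_le_one] at hd hi
  have hlt : t < 1 := lt_of_le_of_ne ht.2 ht1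
  have d1 := (hd ht).hasDerivAt
  have d2 := hi ht 0 (by simp)
  have hle : ∀ᶠ b in 𝓝[>] t, |slope φ t b| ≤ slope (fun x => ∫ s in (0 : ℝ)..x, (H s).toReal) t b := by
    filter_upwards [hb, self_mem_nhdsWithin, Ioc_mem_nhdsGT hlt] with b hb htb hb1
    have htb : t < b := htb
    rw [lintegral_Icc_eq_ofReal_integral ht.1 htb.le hb1.2 hH hfin] at hb
    have hnn : 0 ≤ (∫ s in (0 : ℝ)..b, (H s).toReal) - ∫ s in (0 : ℝ)..t, (H s).toReal := by
      rw [sub_nonneg]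
      exact intervalIntegral.integral_mono_interval le_rfl ht.1 htb.le
        (Eventually.of_forall fun _ => ENNReal.toReal_nonneg)
        ((hint.mono_set (by
          rw [uIcc_of_le (ht.1.trans htb.le)]; exact Icc_subset_Icc le_rfl hb1.2)).intervalIntegrable)
    rw [ENNReal.ofReal_le_ofReal_iff hnn] at hb
    rw [slope_def_field, slope_def_field, abs_div, abs_of_pos (sub_pos.2 htb)]
    exact div_le_div_of_nonneg_right hb (sub_pos.2 htb).le
  have hsub : Ioi t ⊆ {t}ᶜ := fun x hx => ne_of_gt hx
  have t1 := (hasDerivAt_iff_tendsto_slope.1 d1).mono_left (nhdsWithin_mono t hsub)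
  have t2 := (hasDerivAt_iff_tendsto_slope.1 d2).mono_left (nhdsWithin_mono t hsub)
  have := le_of_tendsto_of_tendsto t1.abs t2 hle
  rw [← ofReal_norm, Real.norm_eq_abs]
  exact (ENNReal.ofReal_le_ofReal this).trans ENNReal.ofReal_toReal_le

end realLine

/-! ### Metric speed and subcurves -/

section speed

variable {X : Type*} [MetricSpace X]

/-- The limsup is a countable infimum of suprema over `h`. Each supremum is uncountable, but of
functions continuous in `t`, hence lower semicontinuous. -/
lemma measurable_metricSpeed {γ : ℝ → X} (hγ : Continuous γ) : Measurable (metricSpeed γ) := by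
  have hb : (𝓝[≠] (0 : ℝ)).HasBasis (fun _ : ℕ => True)
      (fun n => Metric.ball 0 (1 / ((n : ℝ) + 1)) ∩ {0}ᶜ) :=
    nhdsWithin_hasBasis Metric.nhds_basis_ball_inv_nat_succ _
  have : metricSpeed γ = fun t => ⨅ n : ℕ, ⨆ h ∈ Metric.ball (0 : ℝ) (1 / ((n : ℝ) + 1)) ∩ {0}ᶜ,
      edist (γ (t + h)) (γ t) / ENNReal.ofReal |h| := by
    ext t
    rw [metricSpeed, hb.limsup_eq_iInf_iSup]
    simp
  rw [this]
  refine Measurable.iInf fun n => LowerSemicontinuous.measurable ?_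
  refine lowerSemicontinuous_iSup fun h => lowerSemicontinuous_iSup fun hh => ?_
  refine Continuous.lowerSemicontinuous ?_
  have h0 : ENNReal.ofReal |h| ≠ 0 := by simpa using hh.2
  simp only [div_eq_mul_inv]
  exact ENNReal.continuous_mul_const (ENNReal.inv_ne_top.2 h0) |>.comp
    ((hγ.comp (continuous_id.add continuous_const)).edist hγ)

lemma metricSpeed_congr {γ γ' : ℝ → X} {t : ℝ} (h : γ =ᶠ[𝓝 t] γ') :
    metricSpeed γ t = metricSpeed γ' t := by
  refine limsup_congr ?_
  have h1 : Tendsto (fun s : ℝ => t + s) (𝓝[≠] 0) (𝓝 t) := by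
    have : Tendsto (fun s : ℝ => t + s) (𝓝 0) (𝓝 (t + 0)) :=
      (continuous_const.add continuous_id).tendsto 0
    rw [add_zero] at this
    exact this.mono_left nhdsWithin_le_nhds
  filter_upwards [h1.eventually h] with s hs
  rw [hs, h.eq_of_nhds]

lemma aemeasurable_metricSpeed {γ : ℝ → X} (hγ : ContinuousOn γ (Icc 0 1)) :
    AEMeasurable (metricSpeed γ) (volume.restrict (Icc 0 1)) := by
  -- Extending the curve by constants outside [0,1] makes it continuous on the line; inside (0,1)
  -- the speed is unchanged, being a local quantity.
  have hc : Continuous (IccExtend (zero_le_one' ℝ) ((Icc (0 : ℝ) 1).domRestrict γ)) :=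
    (continuousOn_iff_continuous_domRestrict.1 hγ).Icc_extend'
  refine ⟨_, measurable_metricSpeed hc, ?_⟩
  have h2 : (Ioo (0 : ℝ) 1 : Set ℝ) =ᵐ[volume] Icc (0 : ℝ) 1 := Ioo_ae_eq_Icc
  rw [← Measure.restrict_congr_set h2]
  refine (ae_restrict_iff' measurableSet_Ioo).2 (Eventually.of_forall fun t ht => ?_)
  refine metricSpeed_congr ?_
  filter_upwards [Ioo_mem_nhds ht.1 ht.2] with s hs
  rw [IccExtend_of_mem _ _ ⟨hs.1.le, hs.2.le⟩]
  rfl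

/-- The distance to `x` is 1-Lipschitz. Where it is not differentiable along the curve, `deriv` is 0
by convention and the bound is trivial. -/
lemma enorm_deriv_dist_le_metricSpeed (γ : ℝ → X) (x : X) (t : ℝ) :
    ‖deriv (fun s => dist (γ s) x) t‖ₑ ≤ metricSpeed γ t := by
  by_cases hd : DifferentiableAt ℝ (fun s => dist (γ s) x) t
  swap
  · simp [deriv_zero_of_not_differentiableAt hd]
  have h1 := hasDerivAt_iff_tendsto_slope_zero.1 hd.hasDerivAt
  have h2 := (continuous_enorm.tendsto _).comp h1
  rw [← h2.limsup_eq]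
  refine limsup_le_limsup ?_
  filter_upwards [self_mem_nhdsWithin] with h hh
  have hpos : 0 < |h| := abs_pos.2 hh
  simp only [Function.comp]
  rw [smul_eq_mul, enorm_mul, enorm_inv hh, mul_comm, ← div_eq_mul_inv, ← ofReal_norm,
    ← ofReal_norm h, edist_dist]
  simp only [Real.norm_eq_abs]
  gcongr
  exact abs_dist_sub_le _ _ _

lemma edist_le_lintegral_metricSpeed {γ : ℝ → X} (hγ : AbsolutelyContinuousOnInterval γ 0 1) :
    edist (γ 1) (γ 0) ≤ ∫⁻ t in Icc (0 : ℝ) 1, metricSpeed γ t := by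
  have hac : AbsolutelyContinuousOnInterval (fun s => dist (γ s) (γ 0)) 0 1 :=
    absolutelyContinuousOnInterval_of_dist_le hγ fun x _ y _ => abs_dist_sub_le _ _ _
  have h := ofReal_abs_sub_le_lintegral_deriv zero_le_one hac
  simp only [dist_self, sub_zero, abs_of_nonneg dist_nonneg, ← edist_dist] at h
  exact h.trans (lintegral_mono fun t => enorm_deriv_dist_le_metricSpeed γ _ t)

/-- The restriction of `γ` to `[a, b]`, parametrized by `[0, 1]`. -/
def subcurve {Y : Type*} (γ : ℝ → Y) (a b : ℝ) (t : ℝ) : Y := γ (a + (b - a) * t)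

lemma subcurve_zero {Y : Type*} (γ : ℝ → Y) (a b : ℝ) : subcurve γ a b 0 = γ a := by simp [subcurve]

lemma subcurve_one {Y : Type*} (γ : ℝ → Y) (a b : ℝ) : subcurve γ a b 1 = γ b := by simp [subcurve]

lemma affine_mem_Icc {a b t : ℝ} (hab : a ≤ b) (ht : t ∈ Icc (0 : ℝ) 1) :
    a + (b - a) * t ∈ Icc a b := by
  obtain ⟨h0, h1⟩ := ht
  constructor <;> nlinarith

lemma IsACCurve.subcurve {U V : Set X} {γ : ℝ → X} (hγ : IsACCurve U γ) {a b : ℝ} (ha : 0 ≤ a)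
    (hab : a ≤ b) (hb : b ≤ 1) (hV : ∀ t ∈ Icc a b, γ t ∈ V) : IsACCurve V (subcurve γ a b) := by
  refine ⟨absolutelyContinuousOnInterval_comp_affine hab (hγ.1.mono ?_),
    fun t ht => hV _ (affine_mem_Icc hab ht)⟩
  rw [uIcc_of_le hab, uIcc_of_le zero_le_one]
  exact Icc_subset_Icc ha hb

lemma metricSpeed_subcurve (γ : ℝ → X) {a b : ℝ} (hab : a < b) (t : ℝ) :
    metricSpeed (subcurve γ a b) t =
      ENNReal.ofReal (b - a) * metricSpeed γ (a + (b - a) * t) := by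
  have hc : 0 < b - a := sub_pos.2 hab
  -- Scaling by the positive factor `b - a` preserves the punctured neighbourhoods of 0, so it may
  -- be substituted in the limsup.
  have hmap : map (fun h : ℝ => (b - a) * h) (𝓝[≠] 0) = 𝓝[≠] 0 := by
    have := (Homeomorph.mulLeft₀ (b - a) hc.ne').isOpenEmbedding.map_nhdsWithin_preimage_eq {0}ᶜ 0
    have hpre : (Homeomorph.mulLeft₀ (b - a) hc.ne') ⁻¹' {0}ᶜ = ({0}ᶜ : Set ℝ) := by
      ext x; simp [hc.ne']
    rw [hpre] at this
    simpa using this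
  conv_rhs => rw [metricSpeed, ← hmap]
  rw [← ENNReal.limsup_const_mul_of_ne_top ENNReal.ofReal_ne_top, ← Filter.limsup_comp]
  refine limsup_congr ?_
  filter_upwards with h
  simp only [Function.comp, subcurve]
  rw [abs_mul, abs_of_pos hc, ENNReal.ofReal_mul hc.le, mul_add, ← add_assoc,
    div_eq_mul_inv, div_eq_mul_inv, ENNReal.mul_inv (Or.inl (by simpa using hab))
      (Or.inl ENNReal.ofReal_ne_top)]
  have h1 : ENNReal.ofReal (b - a) * (ENNReal.ofReal (b - a))⁻¹ = 1 :=
    ENNReal.mul_inv_cancel (by simpa using hab) ENNReal.ofReal_ne_top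
  calc _ = 1 * (edist (γ (a + (b - a) * t + (b - a) * h)) (γ (a + (b - a) * t)) *
        (ENNReal.ofReal |h|)⁻¹) := by rw [one_mul]
    _ = _ := by rw [← h1]; ring

lemma curveIntegral_subcurve (ρ : X → ℝ≥0∞) (γ : ℝ → X) {a b : ℝ} (hab : a < b) :
    curveIntegral ρ (subcurve γ a b) = ∫⁻ t in Icc a b, ρ (γ t) * metricSpeed γ t := by
  have hc : 0 < b - a := sub_pos.2 hab
  have himg : (fun t : ℝ => a + (b - a) * t) '' Icc 0 1 = Icc a b := by
    have : (fun t : ℝ => a + (b - a) * t) = (fun t => (b - a) * t + a) := by ext; ring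
    rw [this, image_affine_Icc' hc]
    simp
  rw [← himg, lintegral_image_eq_lintegral_abs_deriv_mul measurableSet_Icc
    (f' := fun _ => b - a) (fun x _ => ?_) (fun x _ y _ hxy => ?_)]
  · refine lintegral_congr fun t => ?_
    rw [metricSpeed_subcurve γ hab, abs_of_pos hc, subcurve]
    ring
  · simpa using (((hasDerivAt_id x).const_mul (b - a)).const_add a).hasDerivWithinAt
  · simpa [hc.ne'] using hxy

end speed

/-! ### Elementary properties of path integrals -/

section curveIntegral

variable {X : Type*} [MetricSpace X]

lemma curveIntegral_const_mul {c : ℝ≥0∞} (hc : c ≠ ∞) (ρ : X → ℝ≥0∞) (γ : ℝ → X) :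
    curveIntegral (fun x => c * ρ x) γ = c * curveIntegral ρ γ := by
  simp only [curveIntegral, mul_assoc]
  exact lintegral_const_mul' _ _ hc

lemma curveIntegral_congr_of_forall_mem {ρ σ : X → ℝ≥0∞} {γ : ℝ → X}
    (h : ∀ t ∈ Icc (0 : ℝ) 1, ρ (γ t) = σ (γ t)) : curveIntegral ρ γ = curveIntegral σ γ :=
  setLIntegral_congr_fun measurableSet_Icc fun t ht => by simp only [h t ht]

lemma IsACCurve.continuousOn {γ : ℝ → X} {U : Set X} (hγ : IsACCurve U γ) :
    ContinuousOn γ (Icc 0 1) := by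
  intro t ht
  have hac : AbsolutelyContinuousOnInterval (fun s => dist (γ s) (γ t)) 0 1 :=
    absolutelyContinuousOnInterval_of_dist_le hγ.1 fun x _ y _ => abs_dist_sub_le _ _ _
  have h := hac.continuousOn t (by rwa [uIcc_of_le zero_le_one])
  rw [uIcc_of_le zero_le_one] at h
  refine tendsto_iff_dist_tendsto_zero.2 ?_
  simpa only [ContinuousWithinAt, dist_self] using h

end curveIntegral

/-! ### Exceptional curve families and calculus of weak upper gradients -/

section exceptional

variable {X : Type*} [MetricSpace X] [MeasurableSpace X] {p : ℝ} {μ : Measure X} {U V : Set X}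

/-- `P` holds for `p`-almost every absolutely continuous curve in `U`. -/
def AECurve (p : ℝ) (μ : Measure X) (U : Set X) (P : (ℝ → X) → Prop) : Prop :=
  modulus p μ U {γ | IsACCurve U γ ∧ ¬ P γ} = 0

lemma AECurve.mono {P Q : (ℝ → X) → Prop} (hP : AECurve p μ U P)
    (h : ∀ γ, IsACCurve U γ → P γ → Q γ) : AECurve p μ U Q :=
  have hsub : {γ | IsACCurve U γ ∧ ¬ Q γ} ⊆ {γ | IsACCurve U γ ∧ ¬ P γ} :=
    fun γ hγ => ⟨hγ.1, fun hPγ => hγ.2 (h γ hγ.1 hPγ)⟩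
  le_antisymm ((modulus_mono hsub).trans (le_of_eq hP)) bot_le

lemma exists_admissible_of_modulus_eq_zero {Γ : Set (ℝ → X)} (h : modulus p μ U Γ = 0)
    {ε : ℝ≥0∞} (hε : 0 < ε) : ∃ ρ : X → ℝ≥0∞, Measurable ρ ∧ (∀ γ ∈ Γ, 1 ≤ curveIntegral ρ γ) ∧
      ∫⁻ x in U, ρ x ^ p ∂μ < ε := by
  rw [← h] at hε
  simpa only [modulus, iInf_lt_iff, exists_prop] using hε

lemma modulus_eq_zero_of_forall {Γ : Set (ℝ → X)}
    (h : ∀ ε : ℝ≥0∞, 0 < ε → ∃ ρ : X → ℝ≥0∞, Measurable ρ ∧ (∀ γ ∈ Γ, 1 ≤ curveIntegral ρ γ) ∧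
      ∫⁻ x in U, ρ x ^ p ∂μ ≤ ε) : modulus p μ U Γ = 0 := by
  refine le_antisymm (le_of_forall_gt_imp_ge_of_dense fun ε hε => ?_) bot_le
  obtain ⟨ρ, h1, h2, h3⟩ := h ε hε
  exact iInf_le_of_le ρ (iInf_le_of_le h1 (iInf_le_of_le h2 h3))

/-- Countable subadditivity of the modulus on null families: the supremum of admissible densities is
admissible, and its `p`-th power is at most the sum of theirs. -/
lemma aeCurve_all (hp : 0 < p) {P : ℕ → (ℝ → X) → Prop} (h : ∀ i, AECurve p μ U (P i)) :
    AECurve p μ U (fun γ => ∀ i, P i γ) := by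
  refine modulus_eq_zero_of_forall fun ε hε => ?_
  obtain ⟨ε', hpos, hsum⟩ := ENNReal.exists_pos_sum_of_countable' hε.ne' ℕ
  choose ρ hm hadm hint using fun i => exists_admissible_of_modulus_eq_zero (h i) (hpos i)
  refine ⟨fun x => ⨆ i, ρ i x, .iSup hm, ?_, ?_⟩
  · rintro γ ⟨hγ, hn⟩
    obtain ⟨i, hi⟩ := not_forall.1 hn
    exact (hadm i γ ⟨hγ, hi⟩).trans (curveIntegral_mono (fun x => le_iSup (fun i => ρ i x) i) γ)
  · calc ∫⁻ x in U, (⨆ i, ρ i x) ^ p ∂μ ≤ ∫⁻ x in U, ∑' i, ρ i x ^ p ∂μ := by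
          refine lintegral_mono fun x => ?_
          have : (⨆ i, ρ i x) ^ p = ⨆ i, ρ i x ^ p := (ENNReal.orderIsoRpow p hp).map_iSup _
          rw [this]
          exact iSup_le fun i => ENNReal.le_tsum i
      _ = ∑' i, ∫⁻ x in U, ρ i x ^ p ∂μ := lintegral_tsum fun i => ((hm i).pow_const p).aemeasurable
      _ ≤ ∑' i, ε' i := ENNReal.tsum_le_tsum fun i => (hint i).le
      _ ≤ ε := hsum.le

lemma AECurve.and (hp : 1 ≤ p) {P Q : (ℝ → X) → Prop} (hP : AECurve p μ U P)
    (hQ : AECurve p μ U Q) : AECurve p μ U (fun γ => P γ ∧ Q γ) := by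
  have hsub : {γ | IsACCurve U γ ∧ ¬ (P γ ∧ Q γ)} ⊆
      {γ | IsACCurve U γ ∧ ¬ P γ} ∪ {γ | IsACCurve U γ ∧ ¬ Q γ} := by
    rintro γ ⟨hγ, h⟩
    by_cases h' : P γ
    · exact Or.inr ⟨hγ, fun hq => h ⟨h', hq⟩⟩
    · exact Or.inl ⟨hγ, h'⟩
  exact le_antisymm ((modulus_mono hsub).trans ((modulus_union_le hp _ _).trans_eq
    (add_eq_zero.2 ⟨hP, hQ⟩))) bot_le

/-- If the integral of `ρ` along a curve is infinite, then so is that of `ρ / n`. All these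
multiples are therefore admissible, and their `p`-integrals tend to 0. -/
lemma aeCurve_curveIntegral_ne_top (hp : 0 < p) {ρ : X → ℝ≥0∞} (hρ : Measurable ρ)
    (hfin : ∫⁻ x in U, ρ x ^ p ∂μ < ∞) : AECurve p μ U (fun γ => curveIntegral ρ γ ≠ ∞) := by
  refine modulus_eq_zero_of_forall fun ε hε => ?_
  have ht : Tendsto (fun n : ℕ => ((n : ℝ≥0∞)⁻¹) ^ p * ∫⁻ x in U, ρ x ^ p ∂μ) atTop (𝓝 0) := by
    have h1 : Tendsto (fun n : ℕ => ((n : ℝ≥0∞)⁻¹) ^ p) atTop (𝓝 0) := by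
      have := (ENNReal.continuous_rpow_const (y := p)).tendsto 0 |>.comp
        ENNReal.tendsto_inv_nat_nhds_zero
      rwa [ENNReal.zero_rpow_of_pos hp] at this
    simpa using ENNReal.Tendsto.mul_const h1 (Or.inr hfin.ne)
  obtain ⟨n, hn, hn1⟩ := ((ht.eventually_lt_const hε).and (eventually_ge_atTop 1)).exists
  have hc : ((n : ℝ≥0∞)⁻¹) ≠ ∞ := by
    rw [ENNReal.inv_ne_top]; exact_mod_cast (by omega : n ≠ 0)
  have hc0 : ((n : ℝ≥0∞)⁻¹) ≠ 0 := by simp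
  refine ⟨fun x => (n : ℝ≥0∞)⁻¹ * ρ x, hρ.const_mul _, ?_, ?_⟩
  · rintro γ ⟨-, hγ⟩
    rw [curveIntegral_const_mul hc, not_not.1 hγ, ENNReal.mul_top hc0]
    exact le_top
  · simp only [ENNReal.mul_rpow_of_nonneg _ _ hp.le]
    rw [lintegral_const_mul' _ _ (ENNReal.rpow_ne_top_of_nonneg hp.le hc)]
    exact hn.le

/-- A property of almost every curve in `V ⊆ U` holds for all subcurves in `V` of almost every
curve in `U`. -/
lemma AECurve.subcurve (hp : 0 < p) (hV : MeasurableSet V) (hVU : V ⊆ U) {P : (ℝ → X) → Prop}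
    (hP : AECurve p μ V P) :
    AECurve p μ U (fun γ => ∀ a b, 0 ≤ a → a < b → b ≤ 1 → (∀ t ∈ Icc a b, γ t ∈ V) →
      P (subcurve γ a b)) := by
  refine modulus_eq_zero_of_forall fun ε hε => ?_
  obtain ⟨ρ, hm, hadm, hint⟩ := exists_admissible_of_modulus_eq_zero hP hε
  -- Extending the density by zero off `V` costs nothing in the integral over `U`, and only
  -- parameters in [a,b] are needed for admissibility.
  refine ⟨V.indicator ρ, hm.indicator hV, ?_, ?_⟩
  · rintro γ ⟨hγ, hn⟩
    push Not at hn
    obtain ⟨a, b, ha, hab, hb, hmem, hPn⟩ := hn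
    have hs := hγ.subcurve ha hab.le hb hmem
    calc 1 ≤ curveIntegral ρ (NewtonSobolev.subcurve γ a b) := hadm _ ⟨hs, hPn⟩
      _ = curveIntegral (V.indicator ρ) (NewtonSobolev.subcurve γ a b) :=
        curveIntegral_congr_of_forall_mem fun t ht => by rw [indicator_of_mem (hs.2 t ht)]
      _ = ∫⁻ t in Icc a b, V.indicator ρ (γ t) * metricSpeed γ t := curveIntegral_subcurve _ _ hab
      _ ≤ curveIntegral (V.indicator ρ) γ := lintegral_mono_set (Icc_subset_Icc ha hb)
  · have : ∀ x, V.indicator ρ x ^ p = V.indicator (fun x => ρ x ^ p) x := by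
      intro x
      by_cases hx : x ∈ V <;> simp [hx, ENNReal.zero_rpow_of_pos hp]
    simp only [this]
    rw [lintegral_indicator hV, Measure.restrict_restrict hV, inter_eq_left.2 hVU]
    exact hint.le

lemma IsWeakUpperGradient.aeCurve {u : X → ℝ} {g : X → ℝ≥0∞} (h : IsWeakUpperGradient p μ U u g) :
    AECurve p μ U (fun γ => ENNReal.ofReal |u (γ 1) - u (γ 0)| ≤ curveIntegral g γ) := h.2

lemma IsWeakUpperGradient.mono_set (hVU : V ⊆ U) {u : X → ℝ} {g : X → ℝ≥0∞}
    (h : IsWeakUpperGradient p μ U u g) : IsWeakUpperGradient p μ V u g := by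
  refine ⟨h.1, modulus_eq_zero_of_forall fun ε hε => ?_⟩
  obtain ⟨ρ, hm, hadm, hint⟩ := exists_admissible_of_modulus_eq_zero h.2 hε
  exact ⟨ρ, hm, fun γ hγ => hadm γ ⟨⟨hγ.1.1, fun t ht => hVU (hγ.1.2 t ht)⟩, hγ.2⟩,
    (lintegral_mono_set hVU).trans hint.le⟩

lemma IsWeakUpperGradient.aeCurve_subcurve (hp : 0 < p) (hV : MeasurableSet V) (hVU : V ⊆ U)
    {u : X → ℝ} {g : X → ℝ≥0∞} (h : IsWeakUpperGradient p μ V u g) :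
    AECurve p μ U (fun γ => ∀ a b, 0 ≤ a → a ≤ b → b ≤ 1 → (∀ t ∈ Icc a b, γ t ∈ V) →
      ENNReal.ofReal |u (γ b) - u (γ a)| ≤ ∫⁻ t in Icc a b, g (γ t) * metricSpeed γ t) := by
  refine (h.aeCurve.subcurve hp hV hVU).mono fun γ hγ H a b ha hab hb hmem => ?_
  rcases hab.eq_or_lt with rfl | hab
  · simp
  · have := H a b ha hab hb hmem
    rwa [subcurve_one, subcurve_zero, curveIntegral_subcurve _ _ hab] at this

variable [BorelSpace X]

lemma IsACCurve.aemeasurable_comp_mul_metricSpeed {γ : ℝ → X} (hγ : IsACCurve U γ)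
    {g : X → ℝ≥0∞} (hg : Measurable g) :
    AEMeasurable (fun t => g (γ t) * metricSpeed γ t) (volume.restrict (Icc 0 1)) :=
  (hg.comp_aemeasurable (hγ.continuousOn.aemeasurable measurableSet_Icc)).mul
    (aemeasurable_metricSpeed hγ.continuousOn)

/-- Almost every curve spends no length in a given null set. -/
lemma aeCurve_ae_metricSpeed_eq_zero (hp : 0 < p) {E : Set X} (hE : MeasurableSet E)
    (h0 : μ.restrict U E = 0) : AECurve p μ U (fun γ =>
      ∀ᵐ t ∂(volume.restrict (Icc (0 : ℝ) 1)), γ t ∈ E → metricSpeed γ t = 0) := by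
  -- The density equal to ∞ on `E` has vanishing `p`-integral, whereas a finite integral along the
  -- curve forces zero speed almost everywhere in `E`.
  have hm : Measurable (E.indicator (fun _ => (∞ : ℝ≥0∞))) := measurable_const.indicator hE
  have hfin : ∫⁻ x in U, E.indicator (fun _ => (∞ : ℝ≥0∞)) x ^ p ∂μ < ∞ := by
    have : ∫⁻ x in U, E.indicator (fun _ => (∞ : ℝ≥0∞)) x ^ p ∂μ = 0 := by
      rw [lintegral_eq_zero_iff (hm.pow_const p)]
      filter_upwards [measure_eq_zero_iff_ae_notMem.1 h0] with x hx
      simp [hx, ENNReal.zero_rpow_of_pos hp]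
    rw [this]; exact ENNReal.zero_lt_top
  refine (aeCurve_curveIntegral_ne_top hp hm hfin).mono fun γ hγ hfin => ?_
  filter_upwards [ae_lt_top' (hγ.aemeasurable_comp_mul_metricSpeed hm) hfin] with t ht hE
  by_contra hne
  simp [hE, ENNReal.top_mul hne] at ht

/-- Almost every curve with different endpoints leaves a given null set. -/
lemma aeCurve_exists_notMem (hp : 0 < p) {E : Set X} (hE : MeasurableSet E)
    (h0 : μ.restrict U E = 0) : AECurve p μ U (fun γ =>
      γ 1 ≠ γ 0 → ∃ t ∈ Icc (0 : ℝ) 1, γ t ∉ E) := by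
  refine (aeCurve_ae_metricSpeed_eq_zero hp hE h0).mono fun γ hγ h hne => ?_
  by_contra! hcon
  -- A curve contained in `E` would have length zero, hence equal endpoints.
  have h1 : ∫⁻ t in Icc (0 : ℝ) 1, metricSpeed γ t = 0 := by
    rw [lintegral_eq_zero_iff' (aemeasurable_metricSpeed hγ.continuousOn)]
    filter_upwards [h, ae_restrict_mem measurableSet_Icc] with t ht htI using ht (hcon t htI)
  have h2 := edist_le_lintegral_metricSpeed hγ.1
  rw [h1, nonpos_iff_eq_zero, edist_eq_zero] at h2
  exact hne h2

/-- Lowering `g` on a null set does not affect its integral along almost every curve, since such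
curves have zero speed there. -/
lemma IsWeakUpperGradient.mono_ae (hp : 1 ≤ p) {u : X → ℝ} {g k : X → ℝ≥0∞}
    (h : IsWeakUpperGradient p μ U u g) (hk : Measurable k) (hle : ∀ᵐ x ∂(μ.restrict U), g x ≤ k x) :
    IsWeakUpperGradient p μ U u k := by
  have hp0 : 0 < p := zero_lt_one.trans_le hp
  refine ⟨hk, ?_⟩
  have hE : MeasurableSet {x | k x < g x} := measurableSet_lt hk h.1
  have h0 : μ.restrict U {x | k x < g x} = 0 := by
    simpa only [ae_iff, not_le] using hle
  refine ((h.aeCurve.and hp (aeCurve_ae_metricSpeed_eq_zero hp0 hE h0)).mono ?_ :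
    AECurve p μ U _)
  rintro γ hγ ⟨h1, h2⟩
  refine h1.trans (lintegral_mono_ae ?_)
  filter_upwards [h2] with t ht
  rcases le_or_gt (g (γ t)) (k (γ t)) with hle | hlt
  · gcongr
  · simp [ht hlt]

/-- If `g` is a weak upper gradient in `U` and `h` in the open set `V ⊆ U`, then the function equal
to `min g h` in `V` and to `g` elsewhere is a weak upper gradient in `U`. -/
lemma IsWeakUpperGradient.of_min_le (hp : 1 ≤ p) (hU : MeasurableSet U) (hV : IsOpen V)
    (hVU : V ⊆ U) {u : X → ℝ} {g h k : X → ℝ≥0∞}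
    (hg : IsWeakUpperGradient p μ U u g) (hgf : ∫⁻ x in U, g x ^ p ∂μ < ∞)
    (hh : IsWeakUpperGradient p μ V u h) (hhf : ∫⁻ x in V, h x ^ p ∂μ < ∞) (hk : Measurable k)
    (hkV : ∀ x ∈ V, min (g x) (h x) ≤ k x) (hkU : ∀ x ∈ U \ V, g x ≤ k x) :
    IsWeakUpperGradient p μ U u k := by
  have hp0 : 0 < p := zero_lt_one.trans_le hp
  refine ⟨hk, ?_⟩
  -- Extended by zero, `h` has a finite integral along almost every whole curve, including the parts
  -- outside `V`.
  have hif : ∫⁻ x in U, V.indicator h x ^ p ∂μ < ∞ := by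
    have : ∀ x, V.indicator h x ^ p = V.indicator (fun x => h x ^ p) x := by
      intro x
      by_cases hx : x ∈ V <;> simp [hx, ENNReal.zero_rpow_of_pos hp0]
    simp only [this]
    rwa [lintegral_indicator hV.measurableSet, Measure.restrict_restrict hV.measurableSet,
      inter_eq_left.2 hVU]
  have him : Measurable (V.indicator h) := hh.1.indicator hV.measurableSet
  refine ((((hg.aeCurve_subcurve hp0 hU subset_rfl).and hp
    (aeCurve_curveIntegral_ne_top hp0 hg.1 hgf)).and hp
    ((hh.aeCurve_subcurve hp0 hV.measurableSet hVU).and hp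
    (aeCurve_curveIntegral_ne_top hp0 him hif))).mono ?_ : AECurve p μ U _)
  rintro γ hγ ⟨⟨hG, hGf⟩, hH, hHf⟩
  have hGm := hγ.aemeasurable_comp_mul_metricSpeed hg.1
  have hHm := hγ.aemeasurable_comp_mul_metricSpeed him
  have hG' : ∀ a b, 0 ≤ a → a ≤ b → b ≤ 1 → ENNReal.ofReal |u (γ b) - u (γ a)| ≤
      ∫⁻ t in Icc a b, g (γ t) * metricSpeed γ t := fun a b ha hab hb =>
    hG a b ha hab hb fun t ht => hγ.2 t ⟨ha.trans ht.1, ht.2.trans hb⟩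
  -- As u ∘ γ is absolutely continuous, its increment is at most the integral of the modulus of its
  -- derivative, and an almost everywhere bound on that derivative suffices.
  have hac : AbsolutelyContinuousOnInterval (fun t => u (γ t)) 0 1 :=
    absolutelyContinuousOnInterval_of_le_lintegral hGm hGf hG'
  refine (ofReal_abs_sub_le_lintegral_deriv zero_le_one hac).trans (lintegral_mono_ae ?_)
  have h1 : ∀ᵐ t ∂(volume.restrict (Icc (0 : ℝ) 1)), t ≠ 1 :=
    ae_restrict_of_ae (by simp [ae_iff])
  filter_upwards [ae_enorm_deriv_le hac hGm hGf, ae_enorm_deriv_le hac hHm hHf, h1,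
    ae_restrict_mem measurableSet_Icc] with t htG htH ht1 htI
  have hlt : t < 1 := lt_of_le_of_ne htI.2 ht1
  have b1 := htG (by
    filter_upwards [Ioc_mem_nhdsGT hlt] with b hb
    exact hG' t b htI.1 hb.1.le hb.2)
  by_cases htV : γ t ∈ V
  -- The curve stays in the open set `V` for a short time after `t`, so the inequality for `h` holds
  -- on [t,b] for `b` close to `t`.
  · have hnear : ∀ᶠ s in 𝓝[Icc 0 1] t, γ s ∈ V :=
      (hγ.continuousOn t htI).eventually (hV.mem_nhds htV)
    obtain ⟨r, hr, hball⟩ := Metric.mem_nhdsWithin_iff.1 hnear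
    have b2 := htH (by
      filter_upwards [Ioc_mem_nhdsGT (lt_min hlt (by linarith : t < t + r / 2))] with b hb
      have hb1 : b ≤ 1 := hb.2.trans (min_le_left _ _)
      have hb2 : b ≤ t + r / 2 := hb.2.trans (min_le_right _ _)
      have hmem : ∀ s ∈ Icc t b, γ s ∈ V := fun s hs => hball ⟨by
        rw [Metric.mem_ball, Real.dist_eq, abs_lt]
        constructor <;> linarith [hs.1, hs.2], htI.1.trans hs.1, hs.2.trans hb1⟩
      refine (hH t b htI.1 hb.1.le hb1 hmem).trans (le_of_eq ?_)
      refine setLIntegral_congr_fun measurableSet_Icc fun s hs => ?_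
      simp only [indicator_of_mem (hmem s hs)])
    rw [indicator_of_mem htV] at b2
    refine (le_min b1 b2).trans ?_
    rw [← min_mul_of_nonneg _ _ zero_le]
    exact mul_le_mul_left (hkV _ htV) _
  · exact b1.trans (mul_le_mul_left (hkU _ ⟨hγ.2 t htI, htV⟩) _)

end exceptional

/-! ### Existence and locality of minimal weak upper gradients -/

section minimal

variable {X : Type*} [MetricSpace X] [MeasurableSpace X] {p : ℝ} {μ : Measure X} {U V : Set X}

lemma eLpNorm_rpow_eq_lintegral {Y : Type*} [MeasurableSpace Y] (hp : 0 < p) (g : Y → ℝ≥0∞)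
    (ν : Measure Y) : eLpNorm g (ENNReal.ofReal p) ν ^ p = ∫⁻ x, g x ^ p ∂ν := by
  rw [eLpNorm_eq_lintegral_rpow_enorm_toReal (by simpa using hp) ENNReal.ofReal_ne_top,
    ENNReal.toReal_ofReal hp.le, ← ENNReal.rpow_mul, one_div_mul_cancel hp.ne', ENNReal.rpow_one]
  simp

variable {u v : X → ℝ} {g h k : X → ℝ≥0∞}

lemma IsMinWeakUpperGradient.ae_eq (hg : IsMinWeakUpperGradient p μ U u g)
    (hh : IsMinWeakUpperGradient p μ U u h) : g =ᵐ[μ.restrict U] h :=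
  EventuallyLE.antisymm (hg.2.2 h hh.1 hh.2.1) (hh.2.2 g hg.1 hg.2.1)

lemma IsMinWeakUpperGradient.eLpNorm_eq (hp : 1 ≤ p) (hg : IsMinWeakUpperGradient p μ U u g) :
    eLpNorm g (ENNReal.ofReal p) (μ.restrict U) = gradNorm p μ U u := by
  refine le_antisymm (le_iInf₂ fun h hh => ?_) (iInf₂_le g hg.1)
  by_cases hf : ∫⁻ x in U, h x ^ p ∂μ < ∞
  · refine eLpNorm_mono_enorm_ae ?_
    filter_upwards [hg.2.2 h hh hf] with x hx
    simpa using hx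
  · rw [← eLpNorm_lt_top_iff_lintegral hp, not_lt_top_iff] at hf
    rw [hf]
    exact le_top

/-- Sublinearity applied to u = v + (u - v). -/
lemma IsMinWeakUpperGradient.ae_le_add (hp : 1 ≤ p) (hg : IsMinWeakUpperGradient p μ U u g)
    (hh : IsMinWeakUpperGradient p μ U v h) (hk : IsMinWeakUpperGradient p μ U (u - v) k) :
    ∀ᵐ x ∂(μ.restrict U), g x ≤ h x + k x := by
  have hw : IsWeakUpperGradient p μ U u (h + k) := by
    have := hh.1.add hp hk.1
    rwa [add_sub_cancel] at this
  refine hg.2.2 (h + k) hw ((eLpNorm_lt_top_iff_lintegral hp _).1 ?_)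
  exact (eLpNorm_add_le hh.1.1.aestronglyMeasurable hk.1.1.aestronglyMeasurable
    (by simpa using hp)).trans_lt (ENNReal.add_lt_top.2
      ⟨(eLpNorm_lt_top_iff_lintegral hp _).2 hh.2.1, (eLpNorm_lt_top_iff_lintegral hp _).2 hk.2.1⟩)

lemma IsWeakUpperGradient.neg (hu : IsWeakUpperGradient p μ U u g) :
    IsWeakUpperGradient p μ U (-u) g := by
  simpa using hu.smul (-1)

lemma IsMinWeakUpperGradient.neg (hg : IsMinWeakUpperGradient p μ U u g) :
    IsMinWeakUpperGradient p μ U (-u) g :=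
  ⟨hg.1.neg, hg.2.1, fun h hh hhf => hg.2.2 h (by simpa using hh.neg) hhf⟩

variable [BorelSpace X]

/-- A pointwise decreasing limit of integrable weak upper gradients is a weak upper gradient. -/
lemma isWeakUpperGradient_iInf (hp : 1 ≤ p) {k : ℕ → X → ℝ≥0∞}
    (hk : ∀ n, IsWeakUpperGradient p μ U u (k n)) (hanti : Antitone k)
    (hfin : ∫⁻ x in U, k 0 x ^ p ∂μ < ∞) :
    IsWeakUpperGradient p μ U u (fun x => ⨅ n, k n x) := by
  have hp0 : 0 < p := zero_lt_one.trans_le hp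
  refine ⟨.iInf fun n => (hk n).1, ?_⟩
  refine (((aeCurve_all hp0 fun n => (hk n).aeCurve).and hp
    (aeCurve_curveIntegral_ne_top hp0 (hk 0).1 hfin)).mono ?_ : AECurve p μ U _)
  rintro γ hγ ⟨hle, hf⟩
  have hm := fun n => hγ.aemeasurable_comp_mul_metricSpeed (hk n).1
  have hlim : Tendsto (fun n => curveIntegral (k n) γ) atTop
      (𝓝 (curveIntegral (fun x => ⨅ n, k n x) γ)) := by
    refine tendsto_lintegral_of_dominated_convergence' _ hm
      (fun n => ae_of_all _ fun t => mul_le_mul_left (hanti n.zero_le (γ t)) _) hf ?_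
    filter_upwards [ae_lt_top' (hm 0) hf] with t ht
    have hti : Tendsto (fun n => k n (γ t)) atTop (𝓝 (⨅ n, k n (γ t))) :=
      tendsto_atTop_iInf fun m n hmn => hanti hmn (γ t)
    -- Multiplication by ∞ is discontinuous at 0. However, the integrand with `k 0` is finite here,
    -- so infinite speed forces every `k n` to vanish at this point.
    rcases eq_or_ne (metricSpeed γ t) ∞ with hs | hs
    · have h0 : k 0 (γ t) = 0 := by
        by_contra hne
        rw [hs, ENNReal.mul_top hne] at ht
        exact ht.ne rfl
      have h1 : ∀ n, k n (γ t) = 0 := fun n =>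
        le_antisymm ((hanti n.zero_le (γ t)).trans h0.le) bot_le
      simp [h1]
    · exact ENNReal.Tendsto.mul_const hti (Or.inr hs)
  exact ge_of_tendsto' hlim hle

/-- Direct method: running minima turn a minimizing sequence into a decreasing one, whose pointwise
limit attains the infimum `m`. -/
lemma exists_isMinWeakUpperGradient (hp : 1 ≤ p) (hU : IsOpen U)
    (h : ∃ g, IsWeakUpperGradient p μ U u g ∧ ∫⁻ x in U, g x ^ p ∂μ < ∞) :
    ∃ g, IsMinWeakUpperGradient p μ U u g := by
  have hp0 : 0 < p := zero_lt_one.trans_le hp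
  set m : ℝ≥0∞ := ⨅ (g : X → ℝ≥0∞) (_ : IsWeakUpperGradient p μ U u g), ∫⁻ x in U, g x ^ p ∂μ
    with hm
  have hmle : ∀ g, IsWeakUpperGradient p μ U u g → m ≤ ∫⁻ x in U, g x ^ p ∂μ := fun g hg =>
    iInf₂_le g hg
  obtain ⟨g₀, hg₀, hf₀⟩ := h
  have hmfin : m ≠ ∞ := ((hmle g₀ hg₀).trans_lt hf₀).ne
  have hseq : ∀ n : ℕ, ∃ g, IsWeakUpperGradient p μ U u g ∧
      ∫⁻ x in U, g x ^ p ∂μ < m + ((n : ℝ≥0∞) + 1)⁻¹ := by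
    intro n
    have : m < m + ((n : ℝ≥0∞) + 1)⁻¹ := ENNReal.lt_add_right hmfin (by simp)
    conv_lhs at this => rw [hm]
    simpa only [iInf_lt_iff, exists_prop] using this
  choose g hg hgm using hseq
  have hgf : ∀ n, ∫⁻ x in U, g n x ^ p ∂μ < ∞ := fun n =>
    (hgm n).trans_le le_top
  have hinf : ∀ g h : X → ℝ≥0∞, IsWeakUpperGradient p μ U u g → ∫⁻ x in U, g x ^ p ∂μ < ∞ →
      IsWeakUpperGradient p μ U u h → ∫⁻ x in U, h x ^ p ∂μ < ∞ →
      IsWeakUpperGradient p μ U u (fun x => min (g x) (h x)) := fun g h hg hgf hh hhf =>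
    hg.of_min_le hp hU.measurableSet hU subset_rfl hgf hh hhf (hg.1.min hh.1) (fun _ _ => le_rfl)
      (fun x hx => absurd hx.1 hx.2)
  let k : ℕ → X → ℝ≥0∞ := fun n => Nat.rec (g 0) (fun i f x => min (f x) (g (i + 1) x)) n
  have hks : ∀ n x, k (n + 1) x = min (k n x) (g (n + 1) x) := fun n x => rfl
  have hanti : Antitone k := antitone_nat_of_succ_le fun n x => min_le_left _ _
  have hkg : ∀ n x, k n x ≤ g n x := by
    intro n x
    cases n with
    | zero => exact le_rfl
    | succ n => exact min_le_right _ _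
  have hkf : ∀ n, ∫⁻ x in U, k n x ^ p ∂μ < ∞ := fun n =>
    (lintegral_mono fun x => ENNReal.rpow_le_rpow (hkg n x) hp0.le).trans_lt (hgf n)
  have hkw : ∀ n, IsWeakUpperGradient p μ U u (k n) := by
    intro n
    induction n with
    | zero => exact hg 0
    | succ n ih => exact hinf _ _ ih (hkf n) (hg (n + 1)) (hgf (n + 1))
  have hw := isWeakUpperGradient_iInf hp hkw hanti (hkf 0)
  have hle : ∫⁻ x in U, (⨅ n, k n x) ^ p ∂μ ≤ m := by
    have hlim : Tendsto (fun n : ℕ => m + ((n : ℝ≥0∞) + 1)⁻¹) atTop (𝓝 (m + 0)) := by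
      refine tendsto_const_nhds.add ?_
      have := ENNReal.tendsto_inv_nat_nhds_zero.comp (tendsto_add_atTop_nat 1)
      simpa [Function.comp_def] using this
    rw [add_zero] at hlim
    refine ge_of_tendsto' hlim fun n => le_trans (lintegral_mono fun x => ?_) (hgm n).le
    exact ENNReal.rpow_le_rpow ((iInf_le _ n).trans (hkg n x)) hp0.le
  have hfin : ∫⁻ x in U, (⨅ n, k n x) ^ p ∂μ < ∞ := hle.trans_lt hmfin.lt_top
  refine ⟨_, hw, hfin, fun h hh hhf => ?_⟩
  -- The minimum with any competitor `h` is again a weak upper gradient, so its integral is at least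
  -- `m`. It lies below the candidate, whose integral is at most `m`, so the two agree almost
  -- everywhere.
  have hmin := hinf _ _ hw hfin hh hhf
  have hlemin : ∀ x, min (⨅ n, k n x) (h x) ^ p ≤ (⨅ n, k n x) ^ p := fun x =>
    ENNReal.rpow_le_rpow (min_le_left _ _) hp0.le
  filter_upwards [ae_eq_of_ae_le_of_lintegral_le (ae_of_all _ hlemin)
    ((lintegral_mono hlemin).trans_lt hfin).ne (hw.1.pow_const p).aemeasurable
    (hle.trans (hmle _ hmin))] with x hx
  have := ENNReal.rpow_left_injective hp0.ne' hx
  exact min_eq_left_iff.1 this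

lemma MemNewton.exists_isMin (hp : 1 ≤ p) (hU : IsOpen U) (hu : MemNewton p μ U u) :
    ∃ g, IsMinWeakUpperGradient p μ U u g :=
  exists_isMinWeakUpperGradient hp hU hu.2

lemma IsMinWeakUpperGradient.congr_ae (hp : 1 ≤ p) (hg : IsMinWeakUpperGradient p μ U u g)
    (hk : Measurable k) (h : k =ᵐ[μ.restrict U] g) : IsMinWeakUpperGradient p μ U u k := by
  refine ⟨hg.1.mono_ae hp hk (h.symm.le), ?_, fun f hf hff => ?_⟩
  · have : ∫⁻ x in U, k x ^ p ∂μ = ∫⁻ x in U, g x ^ p ∂μ :=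
      lintegral_congr_ae (h.fun_comp (· ^ p))
    exact this.trans_lt hg.2.1
  · exact h.le.trans (hg.2.2 f hf hff)

/-- A competitor that is smaller in `V` can be pasted into `g` there, which would contradict
minimality in `U`. -/
lemma IsMinWeakUpperGradient.mono_set (hp : 1 ≤ p) (hU : IsOpen U) (hV : IsOpen V) (hVU : V ⊆ U)
    (hg : IsMinWeakUpperGradient p μ U u g) : IsMinWeakUpperGradient p μ V u g := by
  classical
  have hp0 : 0 < p := zero_lt_one.trans_le hp
  refine ⟨hg.1.mono_set hVU, (lintegral_mono_set hVU).trans_lt hg.2.1, fun h hh hhf => ?_⟩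
  let k : X → ℝ≥0∞ := V.piecewise (fun x => min (g x) (h x)) g
  have hkm : Measurable k := Measurable.piecewise hV.measurableSet (hg.1.1.min hh.1) hg.1.1
  have hkg : ∀ x, k x ≤ g x := by
    intro x
    by_cases hx : x ∈ V <;> simp [k, hx]
  have hk : IsWeakUpperGradient p μ U u k :=
    hg.1.of_min_le hp hU.measurableSet hV hVU hg.2.1 hh hhf hkm (fun x hx => by simp [k, hx])
      (fun x hx => by simp [k, hx.2])
  have hle := hg.2.2 k hk
    ((lintegral_mono fun x => ENNReal.rpow_le_rpow (hkg x) hp0.le).trans_lt hg.2.1)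
  filter_upwards [ae_restrict_of_ae_restrict_of_subset hVU hle,
    ae_restrict_mem hV.measurableSet] with x hx hxV
  refine hx.trans ?_
  simp [k, hxV]

end minimal

/-! ### Exhaustions of Ω and gluing of gradients -/

section exhaustion

variable {X : Type*} [MetricSpace X] {Ω : Set X}

/-- An increasing sequence of open sets `U n ⋐ Ω` that absorbs every `V ⋐ Ω`. -/
structure IsExhaustion (Ω : Set X) (U : ℕ → Set X) : Prop where
  isOpen : ∀ n, IsOpen (U n)
  mono : Monotone U
  wellInside : ∀ n, WellInside (U n) Ω
  cofinal : ∀ V, WellInside V Ω → ∃ n, V ⊆ U n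

lemma exists_isExhaustion (Ω : Set X) : ∃ U : ℕ → Set X, IsExhaustion Ω U := by
  rcases isEmpty_or_nonempty X with hX | ⟨⟨x₀⟩⟩
  · refine ⟨fun _ => ∅, fun _ => isOpen_empty, fun _ _ _ => le_rfl, fun _ => ?_, fun V _ => ⟨0, ?_⟩⟩
    · exact ⟨empty_subset _, Bornology.isBounded_empty, 1, one_pos, fun x => isEmptyElim x⟩
    · exact fun x => isEmptyElim x
  -- The extended distance is used because the complement of Ω may be empty; it is then ∞ and the
  -- condition is void.
  let U : ℕ → Set X := fun n =>
    Metric.ball x₀ n ∩ {x | ENNReal.ofReal (1 / ((n : ℝ) + 1)) < Metric.infEDist x Ωᶜ}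
  have hdist : ∀ n, ∀ x ∈ U n, ∀ y ∉ Ω, 1 / ((n : ℝ) + 1) ≤ dist x y := by
    intro n x hx y hy
    have h1 : ENNReal.ofReal (1 / ((n : ℝ) + 1)) < edist x y :=
      lt_of_lt_of_le hx.2 (Metric.infEDist_le_edist_of_mem hy)
    rw [edist_dist, ENNReal.ofReal_lt_ofReal_iff_of_nonneg (by positivity)] at h1
    exact h1.le
  refine ⟨U, fun n => ?_, fun m n hmn x hx => ⟨?_, ?_⟩, fun n => ⟨?_, ?_, ?_⟩, ?_⟩
  · exact Metric.isOpen_ball.inter (isOpen_lt continuous_const Metric.continuous_infEDist)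
  · exact Metric.ball_subset_ball (by exact_mod_cast hmn) hx.1
  · refine lt_of_le_of_lt (ENNReal.ofReal_le_ofReal ?_) hx.2
    exact Nat.one_div_le_one_div hmn
  · intro x hx
    by_contra hxΩ
    have := hdist n x hx x hxΩ
    rw [dist_self] at this
    exact absurd this (not_le.2 (by positivity))
  · exact Metric.isBounded_ball.subset inter_subset_left
  · exact ⟨_, by positivity, hdist n⟩
  · rintro V ⟨-, hb, r, hr, hd⟩
    obtain ⟨R, hR⟩ := hb.subset_ball x₀
    obtain ⟨n, hn⟩ := exists_nat_gt (max R (1 / r))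
    have hn1 : R < n := (le_max_left _ _).trans_lt hn
    have hn2 : 1 / r < n := (le_max_right _ _).trans_lt hn
    refine ⟨n, fun x hx => ⟨Metric.ball_subset_ball hn1.le (hR hx), ?_⟩⟩
    have h1 : ENNReal.ofReal r ≤ Metric.infEDist x Ωᶜ := by
      refine Metric.le_infEDist.2 fun y hy => ?_
      rw [edist_dist]
      exact ENNReal.ofReal_le_ofReal (hd x hx y hy)
    refine lt_of_lt_of_le ((ENNReal.ofReal_lt_ofReal_iff hr).2 ?_) h1
    rw [div_lt_iff₀ (by positivity)]
    rw [div_lt_iff₀ hr] at hn2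
    nlinarith

/-- In the maximum metric, moving only in space or only to the times 0 and τ shows that both
projections of `K` keep the distance `r` from the respective complements. -/
lemma WellInside.exists_subset_prod {τ : ℝ} {K : Set (X × ℝ)}
    (hK : WellInside K (Ω ×ˢ Ioo 0 τ)) :
    ∃ (U : Set X) (a b : ℝ), IsOpen U ∧ WellInside U Ω ∧ 0 < a ∧ b < τ ∧ K ⊆ U ×ˢ Icc a b := by
  obtain ⟨hsub, hb, r, hr, hd⟩ := hK
  obtain ⟨U, hU⟩ := exists_isExhaustion Ω
  have hA : WellInside (Prod.fst '' K) Ω := by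
    refine ⟨?_, hb.image_fst, r, hr, ?_⟩
    · rintro _ ⟨z, hz, rfl⟩
      exact (hsub hz).1
    · rintro _ ⟨z, hz, rfl⟩ y hy
      have := hd z hz (y, z.2) fun h => hy h.1
      rw [Prod.dist_eq, dist_self, max_eq_left dist_nonneg] at this
      exact this
  obtain ⟨n, hn⟩ := hU.cofinal _ hA
  refine ⟨U n, r, τ - r, hU.isOpen n, hU.wellInside n, hr, by linarith, fun z hz =>
    ⟨hn (mem_image_of_mem _ hz), ?_, ?_⟩⟩
  · have := hd z hz (z.1, 0) fun h => lt_irrefl _ h.2.1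
    rw [Prod.dist_eq, dist_self, max_eq_right dist_nonneg, Real.dist_eq, sub_zero,
      abs_of_pos (hsub hz).2.1] at this
    exact this
  · have := hd z hz (z.1, τ) fun h => lt_irrefl _ h.2.2
    rw [Prod.dist_eq, dist_self, max_eq_right dist_nonneg, Real.dist_eq,
      abs_of_neg (by linarith [(hsub hz).2.2])] at this
    linarith

variable [MeasurableSpace X] [BorelSpace X] {p : ℝ} {μ : Measure X}

/-- By locality and almost everywhere uniqueness, the `g m` agree where their domains overlap, so
the supremum merely selects the common value. -/
lemma IsExhaustion.isMinWeakUpperGradientLoc_iSup (hp : 1 ≤ p) {U : ℕ → Set X}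
    (hU : IsExhaustion Ω U) {u : X → ℝ} {g : ℕ → X → ℝ≥0∞}
    (hg : ∀ n, IsMinWeakUpperGradient p μ (U n) u (g n)) :
    IsMinWeakUpperGradientLoc p μ Ω u (fun x => ⨆ n, (U n).indicator (g n) x) := by
  intro V hV hVΩ
  obtain ⟨n, hn⟩ := hU.cofinal V hVΩ
  refine IsMinWeakUpperGradient.mono_set hp (hU.isOpen n) hV hn ((hg n).congr_ae hp ?_ ?_)
  · exact .iSup fun m => (hg m).1.1.indicator (hU.isOpen m).measurableSet
  have key : ∀ m, ∀ᵐ x ∂(μ.restrict (U n)), x ∈ U m → g m x = g n x := by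
    intro m
    rcases le_total m n with hmn | hmn
    · have := (hg m).ae_eq ((hg n).mono_set hp (hU.isOpen n) (hU.isOpen m) (hU.mono hmn))
      refine ae_restrict_of_ae ?_
      exact (ae_restrict_iff' (hU.isOpen m).measurableSet).1 this
    · have := ((hg m).mono_set hp (hU.isOpen m) (hU.isOpen n) (hU.mono hmn)).ae_eq (hg n)
      filter_upwards [this] with x hx _ using hx
  filter_upwards [ae_all_iff.2 key, ae_restrict_mem (hU.isOpen n).measurableSet] with x hx hxn
  refine le_antisymm (iSup_le fun m => ?_) ?_
  · by_cases hm : x ∈ U m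
    · rw [indicator_of_mem hm, hx m hm]
    · rw [indicator_of_notMem hm]; exact bot_le
  · refine le_trans (le_of_eq ?_) (le_iSup _ n)
    rw [indicator_of_mem hxn]

end exhaustion

/-! ### Limits of sequences with summable increments -/

section limits

/-- Minkowski's inequality for partial sums, followed by monotone convergence. -/
lemma eLpNorm_tsum_le {Y : Type*} [MeasurableSpace Y] {ν : Measure Y} {p : ℝ} (hp : 1 ≤ p)
    {g : ℕ → Y → ℝ≥0∞} (hg : ∀ n, AEMeasurable (g n) ν) :
    eLpNorm (fun x => ∑' n, g n x) (ENNReal.ofReal p) ν ≤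
      ∑' n, eLpNorm (g n) (ENNReal.ofReal p) ν := by
  have hp0 : 0 < p := zero_lt_one.trans_le hp
  refine (ENNReal.rpow_le_rpow_iff hp0).1 ?_
  rw [eLpNorm_rpow_eq_lintegral hp0]
  have h1 : ∀ x, (∑' n, g n x) ^ p = ⨆ n, (∑ i ∈ Finset.range n, g i x) ^ p := by
    intro x
    rw [ENNReal.tsum_eq_iSup_nat]
    exact (ENNReal.orderIsoRpow p hp0).map_iSup _
  simp only [h1]
  rw [lintegral_iSup' (fun n => (Finset.aemeasurable_fun_sum _ fun i _ => hg i).pow_const p)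
    (ae_of_all _ fun x m n hmn => ENNReal.rpow_le_rpow (Finset.sum_le_sum_of_subset
      (Finset.range_mono hmn)) hp0.le)]
  refine iSup_le fun n => ?_
  rw [← eLpNorm_rpow_eq_lintegral hp0]
  refine ENNReal.rpow_le_rpow ?_ hp0.le
  have := eLpNorm_sum_le (μ := ν) (p := ENNReal.ofReal p) (f := g) (s := Finset.range n)
    (fun i _ => (hg i).aestronglyMeasurable) (by simpa using hp)
  refine le_trans (le_of_eq ?_) (this.trans (ENNReal.sum_le_tsum _))
  congr 1
  ext x
  simp

lemma tendsto_limUnder_of_tsum_ne_top {a : ℕ → ℝ} {m : ℕ}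
    (h : ∑' k, ‖a (m + k + 1) - a (m + k)‖ₑ ≠ ∞) : Tendsto a atTop (𝓝 (limUnder atTop a)) := by
  have hc : CauchySeq (fun k => a (m + k)) := by
    refine cauchySeq_of_edist_le_of_tsum_ne_top _ (fun n => ?_) h
    rw [edist_comm, edist_eq_enorm_sub]
    rfl
  obtain ⟨l, hl⟩ := cauchySeq_tendsto_of_complete hc
  have hl' : Tendsto a atTop (𝓝 l) := by
    rw [← tendsto_add_atTop_iff_nat m]
    simpa only [add_comm m] using hl
  exact tendsto_nhds_limUnder ⟨l, hl'⟩

lemma enorm_sub_le_tsum {a : ℕ → ℝ} {l : ℝ} (m : ℕ) (h : Tendsto a atTop (𝓝 l)) :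
    ‖l - a m‖ₑ ≤ ∑' k, ‖a (m + k + 1) - a (m + k)‖ₑ := by
  have hl : Tendsto (fun k => a (m + k)) atTop (𝓝 l) := by
    have := (tendsto_add_atTop_iff_nat m).2 h
    simpa only [add_comm m] using this
  have := edist_le_tsum_of_edist_le_of_tendsto₀ (fun k => ‖a (m + k + 1) - a (m + k)‖ₑ)
    (fun n => by rw [edist_comm, edist_eq_enorm_sub]; rfl) hl
  rwa [edist_comm, edist_eq_enorm_sub, add_zero] at this

variable {X : Type*} [MetricSpace X] [MeasurableSpace X] {p : ℝ} {μ : Measure X} {U V : Set X}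

lemma MemNewton.mono_set (hVU : V ⊆ U) {u : X → ℝ} (hu : MemNewton p μ U u) :
    MemNewton p μ V u := by
  obtain ⟨h1, g, hg, hf⟩ := hu
  exact ⟨h1.mono_measure (Measure.restrict_mono hVU le_rfl), g, hg.mono_set hVU,
    (lintegral_mono_set hVU).trans_lt hf⟩

lemma MemNewton.sub (hp : 1 ≤ p) {u v : X → ℝ} (hu : MemNewton p μ U u) (hv : MemNewton p μ U v) :
    MemNewton p μ U (u - v) := by
  have := hu.add hp (hv.smul hp (-1))
  rwa [neg_one_smul, ← sub_eq_add_neg] at this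

lemma gradNorm_mono_set (hVU : V ⊆ U) (u : X → ℝ) : gradNorm p μ V u ≤ gradNorm p μ U u :=
  le_iInf₂ fun g hg => (iInf₂_le g (hg.mono_set hVU)).trans
    (eLpNorm_mono_measure _ (Measure.restrict_mono hVU le_rfl))

lemma newtonENorm_mono_set (hp : 0 < p) (hVU : V ⊆ U) (u : X → ℝ) :
    newtonENorm p μ V u ≤ newtonENorm p μ U u := by
  unfold newtonENorm
  gcongr
  exact gradNorm_mono_set hVU u

lemma eLpNorm_le_newtonENorm (hp : 0 < p) (u : X → ℝ) :
    eLpNorm u (ENNReal.ofReal p) (μ.restrict U) ≤ newtonENorm p μ U u := by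
  rw [newtonENorm, one_div, ENNReal.le_rpow_inv_iff hp]
  exact le_self_add

lemma gradNorm_le_newtonENorm (hp : 0 < p) (u : X → ℝ) :
    gradNorm p μ U u ≤ newtonENorm p μ U u := by
  rw [newtonENorm, one_div, ENNReal.le_rpow_inv_iff hp]
  exact le_add_self

lemma newtonENorm_le_add (hp : 1 ≤ p) (u : X → ℝ) : newtonENorm p μ U u ≤
    eLpNorm u (ENNReal.ofReal p) (μ.restrict U) + gradNorm p μ U u := by
  have hp0 : 0 < p := zero_lt_one.trans_le hp
  rw [newtonENorm, one_div, ENNReal.rpow_inv_le_iff hp0]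
  exact ENNReal.add_rpow_le_rpow_add _ _ hp

variable [BorelSpace X]

/-- If the increments `a (m + k + 1) - a (m + k)` have weak upper gradients `g k` with `p`-integrable
sum and are absolutely summable off a null set, then `∑ g k` is a weak upper gradient of the
pointwise limit minus `a m`. -/
lemma isWeakUpperGradient_limUnder_sub (hp : 1 ≤ p) (hU : MeasurableSet U) {a : ℕ → X → ℝ} (m : ℕ)
    {g : ℕ → X → ℝ≥0∞}
    (hg : ∀ k, IsWeakUpperGradient p μ U (a (m + k + 1) - a (m + k)) (g k))
    (hgf : ∫⁻ x in U, (∑' k, g k x) ^ p ∂μ < ∞)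
    (hae : ∀ᵐ x ∂(μ.restrict U), ∑' k, ‖a (m + k + 1) x - a (m + k) x‖ₑ ≠ ∞) :
    IsWeakUpperGradient p μ U ((fun x => limUnder atTop (fun k => a k x)) - a m)
      (fun x => ∑' k, g k x) := by
  have hp0 : 0 < p := zero_lt_one.trans_le hp
  have hgm : Measurable (fun x => ∑' k, g k x) := .tsum fun k => (hg k).1
  refine ⟨hgm, ?_⟩
  -- The divergence set need not be measurable, so a measurable null hull replaces it.
  set E := toMeasurable (μ.restrict U) {x | ¬ ∑' k, ‖a (m + k + 1) x - a (m + k) x‖ₑ ≠ ∞} with hE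
  have hE0 : μ.restrict U E = 0 := by
    rw [hE, measure_toMeasurable]
    exact hae
  refine ((((aeCurve_all hp0 fun k => (hg k).aeCurve_subcurve hp0 hU subset_rfl).and hp
    (aeCurve_curveIntegral_ne_top hp0 hgm hgf)).and hp
    (aeCurve_exists_notMem hp0 (measurableSet_toMeasurable _ _) hE0)).mono ?_ : AECurve p μ U _)
  rintro γ hγ ⟨⟨hsub, hfin⟩, hex⟩
  -- For equal endpoints the increment vanishes; otherwise the curve has a point off `E`.
  by_cases hne : γ 1 = γ 0
  · simp [hne]
  obtain ⟨t, ht, htE⟩ := hex hne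
  have htD : ∑' k, ‖a (m + k + 1) (γ t) - a (m + k) (γ t)‖ₑ ≠ ∞ := by
    by_contra hcon
    exact htE (subset_toMeasurable _ _ (not_not.2 hcon))
  have hsum : ∑' k, curveIntegral (g k) γ = curveIntegral (fun x => ∑' k, g k x) γ := by
    unfold curveIntegral
    rw [← lintegral_tsum fun k => hγ.aemeasurable_comp_mul_metricSpeed (hg k).1]
    simp only [ENNReal.tsum_mul_right]
  have hseg : ∀ k x y, 0 ≤ x → x ≤ y → y ≤ 1 →
      ‖(a (m + k + 1) (γ y) - a (m + k) (γ y)) - (a (m + k + 1) (γ x) - a (m + k) (γ x))‖ₑ ≤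
        curveIntegral (g k) γ := by
    intro k x y hx hxy hy
    have := hsub k x y hx hxy hy fun s hs => hγ.2 s ⟨hx.trans hs.1, hs.2.trans hy⟩
    rw [← ofReal_norm, Real.norm_eq_abs]
    exact this.trans (lintegral_mono_set (Icc_subset_Icc hx hy))
  -- Convergence spreads from `γ t` to the whole curve: the `k`-th increments at `γ s` and `γ t`
  -- differ by at most the integral of `g k` along the curve, and these integrals are summable.
  have hconv : ∀ s ∈ Icc (0 : ℝ) 1,
      Tendsto (fun k => a k (γ s)) atTop (𝓝 (limUnder atTop (fun k => a k (γ s)))) := by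
    intro s hs
    refine tendsto_limUnder_of_tsum_ne_top (m := m) (ne_top_of_le_ne_top
      (ENNReal.add_ne_top.2 ⟨htD, hfin⟩) ?_)
    rw [← hsum, ← ENNReal.tsum_add]
    refine ENNReal.tsum_le_tsum fun k => ?_
    have h1 : ‖(a (m + k + 1) (γ s) - a (m + k) (γ s)) -
        (a (m + k + 1) (γ t) - a (m + k) (γ t))‖ₑ ≤ curveIntegral (g k) γ := by
      rcases le_total t s with hts | hts
      · exact hseg k t s ht.1 hts hs.2
      · rw [enorm_sub_rev]
        exact hseg k s t hs.1 hts ht.2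
    calc _ = ‖(a (m + k + 1) (γ t) - a (m + k) (γ t)) + ((a (m + k + 1) (γ s) - a (m + k) (γ s)) -
        (a (m + k + 1) (γ t) - a (m + k) (γ t)))‖ₑ := by rw [add_sub_cancel]
      _ ≤ _ := (enorm_add_le _ _).trans (add_le_add le_rfl h1)
  have hlim := (hconv 1 (by simp)).sub (hconv 0 (by simp))
  have hfinal := enorm_sub_le_tsum m hlim
  rw [← hsum]
  refine le_trans (le_of_eq ?_) (hfinal.trans (ENNReal.tsum_le_tsum fun k => ?_))
  · rw [← Real.norm_eq_abs, ofReal_norm]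
    congr 1
    simp only [Pi.sub_apply]
    ring
  · refine le_trans (le_of_eq ?_) (hseg k 0 1 le_rfl zero_le_one le_rfl)
    congr 1
    ring

/-- Local completeness of the Newton-Sobolev spaces: a sequence with summable increments in an
increasing sequence of open sets converges to a single function on all of them. -/
lemma exists_newton_limit (hp : 1 ≤ p) {U : ℕ → Set X} (hUo : ∀ n, IsOpen (U n)) (hU : Monotone U)
    {u : ℕ → X → ℝ} (hu : ∀ n, MemNewton p μ (U n) (u n)) {c : ℕ → ℝ≥0∞} (hc : ∑' n, c n ≠ ∞)
    (hle : ∀ n, newtonENorm p μ (U n) (u (n + 1) - u n) ≤ c n) :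
    ∃ v : X → ℝ, ∀ n m, n ≤ m → MemNewton p μ (U n) v ∧
      newtonENorm p μ (U n) (v - u m) ≤ ∑' k, c (m + k) + ∑' k, c (m + k) := by
  have hp0 : 0 < p := zero_lt_one.trans_le hp
  have hc' : ∀ m, ∑' k, c (m + k) ≠ ∞ := fun m => ne_top_of_le_ne_top hc
    (ENNReal.tsum_comp_le_tsum_of_injective (add_right_injective m) c)
  -- The limit depends on neither `n` nor `m`. Where the sequence diverges, `limUnder` takes an
  -- arbitrary value; this happens only on a null set in each `U n`.
  refine ⟨fun x => limUnder atTop (fun k => u k x), fun n m hnm => ?_⟩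
  have hmem : ∀ k, MemNewton p μ (U n) (u (m + k)) := fun k =>
    (hu (m + k)).mono_set (hU (hnm.trans (Nat.le_add_right m k)))
  have hw : ∀ k, MemNewton p μ (U n) (u (m + k + 1) - u (m + k)) := fun k =>
    (hmem (k + 1)).sub hp (hmem k)
  have hwle : ∀ k, newtonENorm p μ (U n) (u (m + k + 1) - u (m + k)) ≤ c (m + k) := fun k =>
    (newtonENorm_mono_set hp0 (hU (hnm.trans (Nat.le_add_right m k))) _).trans (hle (m + k))
  choose g hg using fun k => (hw k).exists_isMin hp (hUo n)
  have hgsum : eLpNorm (fun x => ∑' k, g k x) (ENNReal.ofReal p) (μ.restrict (U n)) ≤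
      ∑' k, c (m + k) := by
    refine (eLpNorm_tsum_le hp fun k => (hg k).1.1.aemeasurable).trans
      (ENNReal.tsum_le_tsum fun k => ?_)
    rw [(hg k).eLpNorm_eq hp]
    exact (gradNorm_le_newtonENorm hp0 _).trans (hwle k)
  have hDm : ∀ k, AEMeasurable (fun x => ‖u (m + k + 1) x - u (m + k) x‖ₑ) (μ.restrict (U n)) :=
    fun k => (hw k).1.1.enorm
  have hDsum : eLpNorm (fun x => ∑' k, ‖u (m + k + 1) x - u (m + k) x‖ₑ) (ENNReal.ofReal p)
      (μ.restrict (U n)) ≤ ∑' k, c (m + k) := by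
    refine (eLpNorm_tsum_le hp hDm).trans (ENNReal.tsum_le_tsum fun k => ?_)
    refine le_trans (le_of_eq ?_) ((eLpNorm_le_newtonENorm hp0 _).trans (hwle k))
    exact eLpNorm_enorm _
  have hDae : ∀ᵐ x ∂(μ.restrict (U n)), ∑' k, ‖u (m + k + 1) x - u (m + k) x‖ₑ ≠ ∞ := by
    have h1 := (eLpNorm_lt_top_iff_lintegral hp _).1 (hDsum.trans_lt (hc' m).lt_top)
    filter_upwards [ae_lt_top' ((AEMeasurable.tsum hDm).pow_const p) h1.ne] with x hx
    intro hcon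
    rw [hcon, ENNReal.top_rpow_of_pos hp0] at hx
    exact hx.ne rfl
  have hW := isWeakUpperGradient_limUnder_sub hp (hUo n).measurableSet m (fun k => (hg k).1)
    ((eLpNorm_lt_top_iff_lintegral hp _).1 (hgsum.trans_lt (hc' m).lt_top)) hDae
  have hgrad : gradNorm p μ (U n) ((fun x => limUnder atTop (fun k => u k x)) - u m) ≤
      ∑' k, c (m + k) := (iInf₂_le _ hW).trans hgsum
  have hLp : eLpNorm ((fun x => limUnder atTop (fun k => u k x)) - u m) (ENNReal.ofReal p)
      (μ.restrict (U n)) ≤ ∑' k, c (m + k) := by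
    refine (eLpNorm_mono_enorm_ae ?_).trans hDsum
    filter_upwards [hDae] with x hx
    exact enorm_sub_le_tsum m 
      (tendsto_limUnder_of_tsum_ne_top (a := fun k => u k x) (m := m) hx)
  have hmeas : AEStronglyMeasurable (fun x => limUnder atTop (fun k => u k x))
      (μ.restrict (U n)) := by
    refine aestronglyMeasurable_of_tendsto_ae atTop (fun k => (hmem k).1.1) ?_
    filter_upwards [hDae] with x hx
    have := (tendsto_add_atTop_iff_nat m).2
      (tendsto_limUnder_of_tsum_ne_top (a := fun k => u k x) (m := m) hx)
    simpa only [add_comm m] using this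
  have hum : MemNewton p μ (U n) (u m) := by simpa using hmem 0
  have hsub : MemNewton p μ (U n) ((fun x => limUnder atTop (fun k => u k x)) - u m) :=
    ⟨⟨hmeas.sub hum.1.1, hLp.trans_lt (hc' m).lt_top⟩,
      (gradNorm_lt_top_iff hp _).1 (hgrad.trans_lt (hc' m).lt_top)⟩
  refine ⟨?_, (newtonENorm_le_add hp _).trans (add_le_add hLp hgrad)⟩
  have := hsub.add hp hum
  rwa [sub_add_cancel] at this

end limits

/-! ### N^{1,p}(U) as a Banach space; restriction and gluing -/

section newtonSpace

variable {X : Type*} [MetricSpace X] [MeasurableSpace X] {p : ℝ} [hp : Fact (1 ≤ p)]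
  {μ : Measure X} {U V : Set X}

/-- The element of `Ñ^{1,p}(U)` given by a function. -/
def PreNewton.of (u : X → ℝ) (hu : MemNewton p μ U u) : PreNewton p μ U :=
  (⟨u, hu⟩ : ↥(preNewtonSubmodule p μ U))

/-- The function underlying an element of `Ñ^{1,p}(U)`. -/
def PreNewton.fn (u : PreNewton p μ U) : X → ℝ :=
  Subtype.val (p := fun v => v ∈ preNewtonSubmodule p μ U) u

lemma PreNewton.memNewton (u : PreNewton p μ U) : MemNewton p μ U u.fn :=
  Subtype.property (p := fun v => v ∈ preNewtonSubmodule p μ U) u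

lemma PreNewton.fn_of {u : X → ℝ} (hu : MemNewton p μ U u) : (PreNewton.of u hu).fn = u := rfl

lemma PreNewton.of_sub {u v : X → ℝ} (hu : MemNewton p μ U u) (hv : MemNewton p μ U v) :
    PreNewton.of (u - v) (hu.sub hp.out hv) = PreNewton.of u hu - PreNewton.of v hv := rfl

lemma PreNewton.norm_def (u : PreNewton p μ U) : ‖u‖ = (newtonENorm p μ U u.fn).toReal := rfl

lemma PreNewton.enorm_def (u : PreNewton p μ U) : ‖u‖ₑ = newtonENorm p μ U u.fn := by
  rw [← ofReal_norm, PreNewton.norm_def,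
    ENNReal.ofReal_toReal (u.memNewton.newtonENorm_ne_top hp.out)]

lemma toNewton_of_mem {u : X → ℝ} (hu : MemNewton p μ U u) :
    toNewton p μ U u = SeparationQuotient.mk (PreNewton.of u hu) := dif_pos hu

lemma enorm_toNewton {u : X → ℝ} (hu : MemNewton p μ U u) :
    ‖toNewton p μ U u‖ₑ = newtonENorm p μ U u := by
  rw [toNewton_of_mem hu, ← ofReal_norm, SeparationQuotient.norm_mk, ofReal_norm,
    PreNewton.enorm_def]
  rfl

lemma toNewton_sub {u v : X → ℝ} (hu : MemNewton p μ U u) (hv : MemNewton p μ U v) :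
    toNewton p μ U (u - v) = toNewton p μ U u - toNewton p μ U v := by
  rw [toNewton_of_mem hu, toNewton_of_mem hv, toNewton_of_mem (hu.sub hp.out hv), PreNewton.of_sub]
  rfl

lemma exists_toNewton_eq (w : Newton p μ U) : ∃ u, MemNewton p μ U u ∧ toNewton p μ U u = w := by
  obtain ⟨u, rfl⟩ := SeparationQuotient.surjective_mk w
  exact ⟨u.fn, u.memNewton, toNewton_of_mem u.memNewton⟩

lemma toNewton_eq_of_newtonENorm_eq_zero {u v : X → ℝ} (hu : MemNewton p μ U u)
    (hv : MemNewton p μ U v) (h : newtonENorm p μ U (u - v) = 0) :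
    toNewton p μ U u = toNewton p μ U v := by
  rw [← sub_eq_zero, ← toNewton_sub hu hv, ← enorm_eq_zero, enorm_toNewton (hu.sub hp.out hv), h]

lemma PreNewton.norm_of_mono_set_le (hVU : V ⊆ U) (u : PreNewton p μ U) :
    ‖PreNewton.of u.fn (u.memNewton.mono_set hVU)‖ ≤ ‖u‖ := by
  rw [PreNewton.norm_def, PreNewton.norm_def, PreNewton.fn_of]
  exact ENNReal.toReal_mono (u.memNewton.newtonENorm_ne_top hp.out)
    (newtonENorm_mono_set (zero_lt_one.trans_le hp.out) hVU u.fn)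

/-- The restriction from `N^{1,p}(U)` to `N^{1,p}(V)`, `V ⊆ U`, before passing to quotients. -/
def preNewtonRestrictₗ (hVU : V ⊆ U) : PreNewton p μ U →ₗ[ℝ] PreNewton p μ V where
  toFun u := PreNewton.of u.fn (u.memNewton.mono_set hVU)
  map_add' _ _ := rfl
  map_smul' _ _ := rfl

lemma preNewtonRestrictₗ_apply (hVU : V ⊆ U) (u : PreNewton p μ U) :
    preNewtonRestrictₗ hVU u = PreNewton.of u.fn (u.memNewton.mono_set hVU) := rfl

lemma norm_preNewtonRestrictₗ_le (hVU : V ⊆ U) (u : PreNewton p μ U) :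
    ‖preNewtonRestrictₗ hVU u‖ ≤ 1 * ‖u‖ := by
  rw [one_mul, preNewtonRestrictₗ_apply]
  exact PreNewton.norm_of_mono_set_le hVU u

/-- `preNewtonRestrictₗ` as a continuous linear map. -/
def preNewtonRestrict (hVU : V ⊆ U) : PreNewton p μ U →L[ℝ] PreNewton p μ V :=
  (preNewtonRestrictₗ hVU).mkContinuous 1 (norm_preNewtonRestrictₗ_le hVU)

/-- The restriction from `N^{1,p}(U)` to `N^{1,p}(V)`, `V ⊆ U`. -/
def newtonRestrict (hVU : V ⊆ U) : Newton p μ U →L[ℝ] Newton p μ V :=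
  SeparationQuotient.liftCLM ((SeparationQuotient.mkCLM ℝ (PreNewton p μ V)).comp
    (preNewtonRestrict hVU)) (fun _ _ h => SeparationQuotient.mk_eq_mk.2
      (h.map (preNewtonRestrict hVU).continuous))

lemma newtonRestrict_toNewton (hVU : V ⊆ U) {u : X → ℝ} (hu : MemNewton p μ U u) :
    newtonRestrict hVU (toNewton p μ U u) = toNewton p μ V u := by
  rw [toNewton_of_mem hu, toNewton_of_mem (hu.mono_set hVU)]
  rfl

variable [BorelSpace X]

/-- `N^{1,p}(U)` is a Banach space. -/
lemma completeSpace_newton (hU : IsOpen U) : CompleteSpace (Newton p μ U) := by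
  rw [SeparationQuotient.completeSpace_iff]
  refine Metric.complete_of_convergent_controlled_sequences (fun n => (1 / 2) ^ n)
    (fun n => by positivity) fun u hu => ?_
  have hle : ∀ n, newtonENorm p μ U ((u (n + 1)).fn - (u n).fn) ≤ (1 / 2) ^ n := by
    intro n
    have h1 := (hu n (n + 1) n (Nat.le_succ n) le_rfl).le
    rw [dist_eq_norm] at h1
    have h2 : newtonENorm p μ U ((u (n + 1)).fn - (u n).fn) = ‖u (n + 1) - u n‖ₑ :=
      (PreNewton.enorm_def (u (n + 1) - u n)).symm
    rw [h2, ← ofReal_norm]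
    refine (ENNReal.ofReal_le_ofReal h1).trans (le_of_eq ?_)
    rw [ENNReal.ofReal_pow (by positivity)]
    simp [ENNReal.ofReal_inv_of_pos]
  have hc : ∑' n : ℕ, (1 / 2 : ℝ≥0∞) ^ n ≠ ∞ := by
    rw [ENNReal.tsum_geometric]
    simp
  -- Completeness is the case of a constant sequence of sets.
  obtain ⟨v, hv⟩ := exists_newton_limit hp.out (fun _ => hU) (fun _ _ _ => le_rfl)
    (fun n => (u n).memNewton) hc hle
  refine ⟨PreNewton.of v (hv 0 0 le_rfl).1, ?_⟩
  rw [tendsto_iff_edist_tendsto_0]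
  have hlim : Tendsto (fun m => ∑' k, (1 / 2 : ℝ≥0∞) ^ (m + k) + ∑' k, (1 / 2 : ℝ≥0∞) ^ (m + k))
      atTop (𝓝 0) := by
    have h1 : Tendsto (fun m => ∑' k, (1 / 2 : ℝ≥0∞) ^ (m + k)) atTop (𝓝 0) := by
      simpa only [add_comm] using ENNReal.tendsto_sum_nat_add _ hc
    simpa using h1.add h1
  refine tendsto_of_tendsto_of_tendsto_of_le_of_le tendsto_const_nhds hlim (fun _ => bot_le)
    fun m => ?_
  rw [edist_comm, edist_eq_enorm_sub, PreNewton.enorm_def]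
  exact (hv 0 m (Nat.zero_le m)).2

/-- Compatible elements of `N^{1,p}(U n)`, with `U n` an exhaustion of `Ω`, come from a single
function in `N^{1,p}_loc(Ω)`. -/
lemma IsExhaustion.exists_memNewtonLoc {Ω : Set X} {U : ℕ → Set X} (hU : IsExhaustion Ω U)
    (w : ∀ n, Newton p μ (U n))
    (hw : ∀ n, newtonRestrict (hU.mono n.le_succ) (w (n + 1)) = w n) :
    ∃ v, MemNewtonLoc p μ Ω v ∧ ∀ n, toNewton p μ (U n) v = w n := by
  choose u hu huw using fun n => exists_toNewton_eq (w n)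
  -- Compatibility makes consecutive representatives differ by zero norm. The limit lemma with zero
  -- increments then yields one function representing every class.
  have hle : ∀ n, newtonENorm p μ (U n) (u (n + 1) - u n) ≤ 0 := by
    intro n
    have hu' := (hu (n + 1)).mono_set (hU.mono n.le_succ)
    rw [← enorm_toNewton (hu'.sub hp.out (hu n)), toNewton_sub hu' (hu n),
      ← newtonRestrict_toNewton (hU.mono n.le_succ) (hu (n + 1)), huw, huw, hw]
    simp
  obtain ⟨v, hv⟩ := exists_newton_limit hp.out hU.isOpen hU.mono hu (c := fun _ => 0) (by simp) hle
  refine ⟨v, fun V _ hVΩ => ?_, fun n => ?_⟩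
  · obtain ⟨n, hn⟩ := hU.cofinal V hVΩ
    exact (hv n n le_rfl).1.mono_set hn
  · rw [← huw n]
    refine toNewton_eq_of_newtonENorm_eq_zero (hv n n le_rfl).1 (hu n) ?_
    simpa using (hv n n le_rfl).2

end newtonSpace

/-! ### Approximation by countably valued maps -/

section approximation

/-- The range is separable; taking the first index of a dense sequence within distance 2^{-j} is a
measurable choice. -/
lemma exists_measurable_countable_approx {E T : Type*} [NormedAddCommGroup E] [MeasurableSpace T]
    {H : T → E} (hH : StronglyMeasurable H) : ∃ (c : ℕ → E) (N : ℕ → T → ℕ),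
      (∀ j, Measurable (N j)) ∧ ∀ j t, ‖H t - c (N j t)‖ < (1 / 2 : ℝ) ^ j := by
  classical
  obtain ⟨C, hC, hCd⟩ := hH.isSeparable_range
  -- Adjoining 0 makes the countable set nonempty, as `T` may be empty.
  obtain ⟨c, hc⟩ := (hC.insert (0 : E)).exists_eq_range (insert_nonempty _ _)
  have hdense : ∀ (j : ℕ) t, ∃ i, ‖H t - c i‖ < (1 / 2 : ℝ) ^ j := by
    intro j t
    have h1 : H t ∈ closure (range c) := by
      rw [← hc]
      exact closure_mono (subset_insert _ _) (hCd (mem_range_self t))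
    obtain ⟨_, ⟨i, rfl⟩, hi⟩ := Metric.mem_closure_iff.1 h1 ((1 / 2) ^ j) (by positivity)
    exact ⟨i, by rwa [← dist_eq_norm]⟩
  refine ⟨c, fun j t => Nat.find (hdense j t), fun j => ?_, fun j t => Nat.find_spec (hdense j t)⟩
  exact measurable_find (hdense j) fun i =>
    measurableSet_lt (hH.sub stronglyMeasurable_const).norm.measurable measurable_const

end approximation

/-! ### Jointly measurable minimal gradients -/

section timeDependent

variable {X : Type*} [MetricSpace X] [MeasurableSpace X] [BorelSpace X] {p : ℝ} [hp : Fact (1 ≤ p)]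
  {μ : Measure X} {U : Set X}

/-- If `v j → u` in the Dirichlet seminorm with summable errors, the minimal weak upper gradients
converge almost everywhere. -/
lemma ae_tendsto_isMinWeakUpperGradient (hU : IsOpen U) {u : X → ℝ} (hu : MemNewton p μ U u)
    {v : ℕ → X → ℝ} (hv : ∀ j, MemNewton p μ U (v j)) {g : X → ℝ≥0∞}
    (hg : IsMinWeakUpperGradient p μ U u g) {h : ℕ → X → ℝ≥0∞}
    (hh : ∀ j, IsMinWeakUpperGradient p μ U (v j) (h j))
    (hsum : ∑' j, gradNorm p μ U (u - v j) ≠ ∞) :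
    ∀ᵐ x ∂(μ.restrict U), Tendsto (fun j => h j x) atTop (𝓝 (g x)) := by
  have hp0 : 0 < p := zero_lt_one.trans_le hp.out
  choose k hk using fun j => (hu.sub hp.out (hv j)).exists_isMin hp.out hU
  have hk' : ∀ j, IsMinWeakUpperGradient p μ U (v j - u) (k j) := fun j => by
    simpa using (hk j).neg
  have hkm : ∀ j, AEMeasurable (k j) (μ.restrict U) := fun j => (hk j).1.1.aemeasurable
  have hks : eLpNorm (fun x => ∑' j, k j x) (ENNReal.ofReal p) (μ.restrict U) < ∞ := by
    refine ((eLpNorm_tsum_le hp.out hkm).trans (le_of_eq ?_)).trans_lt hsum.lt_top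
    exact tsum_congr fun j => (hk j).eLpNorm_eq hp.out
  have hkae := ae_lt_top' ((AEMeasurable.tsum hkm).pow_const p)
    ((eLpNorm_lt_top_iff_lintegral hp.out _).1 hks).ne
  have hgae := ae_lt_top' (hg.1.1.aemeasurable.pow_const p) hg.2.1.ne
  filter_upwards [hkae, hgae, ae_all_iff.2 fun j => hg.ae_le_add hp.out (hh j) (hk j),
    ae_all_iff.2 fun j => (hh j).ae_le_add hp.out hg (hk' j)] with x hx hgx h1 h2
  have hk0 : Tendsto (fun j => k j x) atTop (𝓝 0) := by
    refine ENNReal.tendsto_atTop_zero_of_tsum_ne_top fun hcon => ?_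
    rw [hcon, ENNReal.top_rpow_of_pos hp0] at hx
    exact hx.ne rfl
  have hgx' : g x ≠ ∞ := fun hcon => by
    rw [hcon, ENNReal.top_rpow_of_pos hp0] at hgx
    exact hgx.ne rfl
  have l1 : Tendsto (fun j => g x - k j x) atTop (𝓝 (g x)) := by
    simpa using ENNReal.Tendsto.sub (tendsto_const_nhds (x := g x)) hk0 (Or.inl hgx')
  have l2 : Tendsto (fun j => g x + k j x) atTop (𝓝 (g x)) := by
    simpa using (tendsto_const_nhds (x := g x)).add hk0
  exact tendsto_of_tendsto_of_tendsto_of_le_of_le l1 l2 (fun j => tsub_le_iff_right.2 (h1 j)) h2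

/-- A strongly measurable family in `N^{1,p}(U)` has a jointly measurable family of minimal weak
upper gradients. -/
lemma exists_measurable_isMinWeakUpperGradient {T : Type*} [MeasurableSpace T] {ν : Measure T}
    (hU : IsOpen U) {h : T → X → ℝ} (hmem : ∀ᵐ t ∂ν, MemNewton p μ U (h t))
    (hmeas : AEStronglyMeasurable (fun t => toNewton p μ U (h t)) ν) :
    ∃ G : X × T → ℝ≥0∞, Measurable G ∧
      ∀ᵐ t ∂ν, IsMinWeakUpperGradient p μ U (h t) (fun x => G (x, t)) := by
  obtain ⟨H, hHm, hHeq⟩ := hmeas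
  obtain ⟨c, N, hNm, hN⟩ := exists_measurable_countable_approx hHm
  choose D hD hDc using fun i => exists_toNewton_eq (c i)
  -- One gradient is fixed for each of the countably many classes; selecting among them by the
  -- measurable index `N j t` is then jointly measurable.
  choose g hg using fun i => (hD i).exists_isMin hp.out hU
  have hΦ : ∀ j, Measurable (fun y : X × T => g (N j y.2) y.1) := by
    intro j
    have h1 : Measurable (fun z : ℕ × X => g z.1 z.2) :=
      measurable_from_prod_countable_right fun i => (hg i).1.1
    exact h1.comp (((hNm j).comp measurable_snd).prodMk measurable_fst)
  -- The limsup is measurable everywhere and equals the limit wherever that exists.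
  refine ⟨fun y => limsup (fun j => g (N j y.2) y.1) atTop, .limsup hΦ, ?_⟩
  filter_upwards [hmem, hHeq] with t ht hHt
  obtain ⟨g₀, hg₀⟩ := ht.exists_isMin hp.out hU
  have hsum : ∑' j, gradNorm p μ U (h t - D (N j t)) ≠ ∞ := by
    have hgeo : ∑' n : ℕ, (1 / 2 : ℝ≥0∞) ^ n ≠ ∞ := by
      rw [ENNReal.tsum_geometric]
      simp
    refine ne_top_of_le_ne_top hgeo (ENNReal.tsum_le_tsum fun j => ?_)
    refine (gradNorm_le_newtonENorm (zero_lt_one.trans_le hp.out) _).trans ?_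
    rw [← enorm_toNewton (ht.sub hp.out (hD _)), toNewton_sub ht (hD _), hDc, hHt, ← ofReal_norm]
    refine (ENNReal.ofReal_le_ofReal (hN j t).le).trans (le_of_eq ?_)
    rw [ENNReal.ofReal_pow (by positivity)]
    simp [ENNReal.ofReal_inv_of_pos]
  have hGt : Measurable (fun x => limsup (fun j => g (N j t) x) atTop) :=
    .limsup fun j => (hg (N j t)).1.1
  refine hg₀.congr_ae hp.out hGt ?_
  filter_upwards [ae_tendsto_isMinWeakUpperGradient hU ht (fun j => hD (N j t)) hg₀
    (fun j => hg (N j t)) hsum] with x hx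
  exact hx.limsup_eq

lemma IsExhaustion.exists_isParabolicMinUpperGradient {Ω : Set X} {U : ℕ → Set X}
    (hU : IsExhaustion Ω U) {J : Set ℝ} {h : ℝ → X → ℝ}
    (hmem : ∀ᵐ t ∂(volume.restrict J), MemNewtonLoc p μ Ω (h t))
    (hmeas : ∀ n, AEStronglyMeasurable (fun t => toNewton p μ (U n) (h t)) (volume.restrict J)) :
    ∃ G : X × ℝ → ℝ≥0∞, IsParabolicMinUpperGradient p μ Ω J h G := by
  have hmem' : ∀ n, ∀ᵐ t ∂(volume.restrict J), MemNewton p μ (U n) (h t) := fun n => by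
    filter_upwards [hmem] with t ht using ht _ (hU.isOpen n) (hU.wellInside n)
  choose G hGm hG using fun n =>
    exists_measurable_isMinWeakUpperGradient (hU.isOpen n) (hmem' n) (hmeas n)
  refine ⟨fun y => ⨆ n, (U n ×ˢ univ).indicator (G n) y, .iSup fun n =>
    (hGm n).indicator ((hU.isOpen n).measurableSet.prod .univ), ?_⟩
  filter_upwards [ae_all_iff.2 hG] with t ht
  have := hU.isMinWeakUpperGradientLoc_iSup hp.out ht
  convert this using 4 with x n
  by_cases hx : x ∈ U n <;> simp [hx]

end timeDependent

/-! ### Translation and mollification in L^p(ℝ; E) -/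

section bochner

variable {E : Type*} [NormedAddCommGroup E] {p : ℝ}

lemma eLpNorm_rpow_eq_lintegral_enorm {Y : Type*} [MeasurableSpace Y] (hp : 0 < p) (f : Y → E)
    (ν : Measure Y) : eLpNorm f (ENNReal.ofReal p) ν ^ p = ∫⁻ x, ‖f x‖ₑ ^ p ∂ν := by
  rw [← eLpNorm_enorm, eLpNorm_rpow_eq_lintegral hp]

/-- Translations are continuous in `L^p(ℝ; E)`. -/
lemma tendsto_lintegral_translation_sub (hp : 1 ≤ p) {φ : ℝ → E}
    (hφ : MemLp φ (ENNReal.ofReal p) volume) :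
    Tendsto (fun s => ∫⁻ t, ‖φ (t - s) - φ t‖ₑ ^ p) (𝓝 0) (𝓝 0) := by
  have hp0 : 0 < p := zero_lt_one.trans_le hp
  have : Fact (1 ≤ ENNReal.ofReal p) := ⟨by simpa using hp⟩
  let g : ℝ → C(ℝ, ℝ) := fun s => ⟨fun t => t - s, by fun_prop⟩
  have hg : Continuous g :=
    ContinuousMap.continuous_of_continuous_uncurry _ (by
      simp only [Function.uncurry_def, g, ContinuousMap.coe_mk]; fun_prop)
  have hgm : ∀ s, MeasurePreserving (g s) (volume : Measure ℝ) volume := fun s =>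
    measurePreserving_sub_right volume s
  have hcont := (continuous_const (y := hφ.toLp φ)).compMeasurePreservingLp hg hgm
    ENNReal.ofReal_ne_top
  have h1 := tendsto_iff_edist_tendsto_0.1 (hcont.tendsto 0)
  have h2 : ∀ s, edist (Lp.compMeasurePreserving (g s) (hgm s) (hφ.toLp φ))
      (Lp.compMeasurePreserving (g 0) (hgm 0) (hφ.toLp φ)) ^ p =
        ∫⁻ t, ‖φ (t - s) - φ t‖ₑ ^ p := by
    intro s
    rw [Lp.toLp_compMeasurePreserving hφ (hgm s), Lp.toLp_compMeasurePreserving hφ (hgm 0),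
      Lp.edist_toLp_toLp, eLpNorm_rpow_eq_lintegral_enorm hp0]
    simp [g]
  have h3 := ((ENNReal.continuous_rpow_const (y := p)).tendsto 0).comp h1
  rw [ENNReal.zero_rpow_of_pos hp0] at h3
  exact h3.congr h2

/-- Jensen's inequality, as monotonicity of L^p norms on a probability space. -/
lemma lintegral_rpow_le_lintegral_rpow {Y : Type*} [MeasurableSpace Y] (hp : 1 ≤ p)
    {ν : Measure Y} [IsProbabilityMeasure ν] {f : Y → ℝ≥0∞} (hf : AEMeasurable f ν) :
    (∫⁻ x, f x ∂ν) ^ p ≤ ∫⁻ x, f x ^ p ∂ν := by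
  have hp0 : 0 < p := zero_lt_one.trans_le hp
  have h := eLpNorm'_le_eLpNorm'_of_exponent_le one_pos hp ν hf.aestronglyMeasurable
  simp only [eLpNorm', enorm_eq_self, ENNReal.rpow_one, div_one] at h
  rwa [one_div, ENNReal.le_rpow_inv_iff hp0] at h

variable {η : ℝ → ℝ}

lemma IsMollifier.integral_rescale (hη : IsMollifier η) {ε : ℝ} (hε : 0 < ε) :
    ∫ s in (-ε)..ε, ε⁻¹ * η (s / ε) = 1 := by
  rw [intervalIntegral.integral_const_mul, intervalIntegral.integral_comp_div _ hε.ne', neg_div,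
    div_self hε.ne', smul_eq_mul, inv_mul_cancel_left₀ hε.ne',
    intervalIntegral.integral_of_le (by norm_num), ← integral_Icc_eq_integral_Ioc]
  refine (setIntegral_eq_integral_of_forall_compl_eq_zero fun x hx => ?_).trans hη.integral_eq_one
  by_contra hne
  exact hx (hη.support (subset_tsupport _ hne))

lemma IsMollifier.continuous_rescale (hη : IsMollifier η) (ε : ℝ) :
    Continuous (fun s => ε⁻¹ * η (s / ε)) := by
  have := hη.smooth.continuous
  fun_prop

lemma IsMollifier.rescale_nonneg (hη : IsMollifier η) {ε : ℝ} (hε : 0 < ε) (s : ℝ) :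
    0 ≤ ε⁻¹ * η (s / ε) := mul_nonneg (inv_nonneg.2 hε.le) (hη.nonneg _)

lemma IsMollifier.lintegral_rescale (hη : IsMollifier η) {ε : ℝ} (hε : 0 < ε) :
    ∫⁻ s in Ioc (-ε) ε, ENNReal.ofReal (ε⁻¹ * η (s / ε)) = 1 := by
  rw [← ofReal_integral_eq_lintegral_ofReal
    ((hη.continuous_rescale ε).integrableOn_Icc.mono_set Ioc_subset_Icc_self)
    (ae_of_all _ fun s => hη.rescale_nonneg hε s),
    ← intervalIntegral.integral_of_le (by linarith), hη.integral_rescale hε, ENNReal.ofReal_one]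

variable [NormedSpace ℝ E]

lemma MemLp.intervalIntegrable_smul_comp_sub (hp : 1 ≤ p) {φ : ℝ → E}
    (hφ : MemLp φ (ENNReal.ofReal p) volume) {w : ℝ → ℝ} (hw : Continuous w) (t a b : ℝ) :
    IntervalIntegrable (fun s => w s • φ (t - s)) volume a b := by
  have h1 : MemLp (fun s => φ (t - s)) (ENNReal.ofReal p) volume :=
    hφ.comp_measurePreserving (Measure.measurePreserving_sub_left volume t)
  have h2 : LocallyIntegrable (fun s => φ (t - s)) volume := h1.locallyIntegrable (by simpa using hp)
  have h3 : IntervalIntegrable (fun s => φ (t - s)) volume a b :=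
    (h2.integrableOn_isCompact isCompact_uIcc).intervalIntegrable
  exact h3.continuousOn_smul hw.continuousOn

lemma stronglyMeasurable_intervalIntegral_smul_comp_sub {φ : ℝ → E} (hφ : StronglyMeasurable φ)
    {w : ℝ → ℝ} (hw : Continuous w) (a b : ℝ) :
    StronglyMeasurable (fun t => ∫ s in a..b, w s • φ (t - s)) := by
  have h : StronglyMeasurable (fun z : ℝ × ℝ => w z.2 • φ (z.1 - z.2)) :=
    (hw.comp continuous_snd).stronglyMeasurable.smul
      (hφ.comp_measurable (measurable_fst.sub measurable_snd))
  simp only [intervalIntegral]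
  exact h.integral_prod_right'.sub h.integral_prod_right'

variable [CompleteSpace E]

/-- Time mollifications converge in `L^p(ℝ; E)`. -/
lemma IsMollifier.tendsto_lintegral_mollify_sub (hη : IsMollifier η) (hp : 1 ≤ p) {φ : ℝ → E}
    (hφs : StronglyMeasurable φ) (hφ : MemLp φ (ENNReal.ofReal p) volume) :
    Tendsto (fun ε : ℝ => ∫⁻ t, ‖(∫ s in (-ε)..ε, (ε⁻¹ * η (s / ε)) • φ (t - s)) - φ t‖ₑ ^ p)
      (𝓝[>] 0) (𝓝 0) := by
  have hp0 : 0 < p := zero_lt_one.trans_le hp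
  rw [ENNReal.tendsto_nhds_zero]
  intro δ hδ
  have htr := (ENNReal.tendsto_nhds_zero.1 (tendsto_lintegral_translation_sub hp hφ)) δ hδ
  obtain ⟨r, hr, hball⟩ := Metric.eventually_nhds_iff.1 htr
  filter_upwards [Ioo_mem_nhdsGT hr] with ε hε
  have hε0 : 0 < ε := hε.1
  have hw := hη.continuous_rescale ε
  have hwm : Measurable (fun s => ENNReal.ofReal (ε⁻¹ * η (s / ε))) :=
    hw.measurable.ennreal_ofReal
  -- With the probability measure η_ε ds, the mollification at `t` is the `ν`-average of the
  -- translates.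
  set ν : Measure ℝ := (volume.restrict (Ioc (-ε) ε)).withDensity
    (fun s => ENNReal.ofReal (ε⁻¹ * η (s / ε))) with hν
  have : IsProbabilityMeasure ν := ⟨by
    rw [hν, withDensity_apply _ .univ, Measure.restrict_univ, hη.lintegral_rescale hε0]⟩
  have hm2 : Measurable (fun z : ℝ × ℝ => ‖φ (z.1 - z.2) - φ z.1‖ₑ ^ p) :=
    (((hφs.comp_measurable (measurable_fst.sub measurable_snd)).sub
      (hφs.comp_measurable measurable_fst)).enorm).pow_const p
  have hm1 : ∀ t, Measurable (fun s => ‖φ (t - s) - φ t‖ₑ) := fun t =>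
    ((hφs.comp_measurable (measurable_const.sub measurable_id)).sub stronglyMeasurable_const).enorm
  have hpt : ∀ t, ‖(∫ s in (-ε)..ε, (ε⁻¹ * η (s / ε)) • φ (t - s)) - φ t‖ₑ ^ p ≤
      ∫⁻ s, ‖φ (t - s) - φ t‖ₑ ^ p ∂ν := by
    intro t
    -- The weight has total mass 1, so `φ t` can be moved under the integral.
    have h1 : (∫ s in (-ε)..ε, (ε⁻¹ * η (s / ε)) • φ (t - s)) - φ t =
        ∫ s in (-ε)..ε, (ε⁻¹ * η (s / ε)) • (φ (t - s) - φ t) := by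
      have hc : IntervalIntegrable (fun s => (ε⁻¹ * η (s / ε)) • φ t) volume (-ε) ε :=
        (hw.smul continuous_const).intervalIntegrable _ _
      simp only [smul_sub]
      rw [intervalIntegral.integral_sub (MemLp.intervalIntegrable_smul_comp_sub hp hφ hw t _ _)
        hc, intervalIntegral.integral_smul_const,
        hη.integral_rescale hε0, one_smul]
    refine le_trans (ENNReal.rpow_le_rpow ?_ hp0.le)
      (lintegral_rpow_le_lintegral_rpow hp (hm1 t).aemeasurable)
    rw [h1, intervalIntegral.integral_of_le (by linarith)]
    refine (enorm_integral_le_lintegral_enorm _).trans (le_of_eq ?_)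
    rw [hν, lintegral_withDensity_eq_lintegral_mul _ hwm (hm1 t)]
    refine lintegral_congr fun s => ?_
    rw [enorm_smul, Pi.mul_apply, Real.enorm_of_nonneg (hη.rescale_nonneg hε0 s)]
  calc _ ≤ ∫⁻ t, (∫⁻ s, ‖φ (t - s) - φ t‖ₑ ^ p ∂ν) := lintegral_mono hpt
    _ = ∫⁻ s, (∫⁻ t, ‖φ (t - s) - φ t‖ₑ ^ p) ∂ν := lintegral_lintegral_swap hm2.aemeasurable
    _ ≤ ∫⁻ _, δ ∂ν := by
        refine lintegral_mono_ae ?_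
        have hac : ν ≪ volume.restrict (Ioc (-ε) ε) := withDensity_absolutelyContinuous _ _
        filter_upwards [hac.ae_le (ae_restrict_mem measurableSet_Ioc)] with s hs
        refine hball ?_
        rw [Real.dist_eq, sub_zero, abs_lt]
        constructor <;> linarith [hs.1, hs.2, hε.2]
    _ = δ := by simp

end bochner

/-! ### Null sets, measurability and limits in time -/

section times

lemma ae_comp_sub_left {P : ℝ → Prop} (h : ∀ᵐ t, P t) (t : ℝ) : ∀ᵐ s, P (t - s) :=
  (Measure.measurePreserving_sub_left volume t).quasiMeasurePreserving.ae h

lemma ae_comp_sub_right {P : ℝ → Prop} (h : ∀ᵐ t, P t) (s : ℝ) : ∀ᵐ t, P (t - s) :=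
  (measurePreserving_sub_right volume s).quasiMeasurePreserving.ae h

lemma aestronglyMeasurable_Ioo_of_Icc {E : Type*} [TopologicalSpace E]
    [TopologicalSpace.PseudoMetrizableSpace E] {g : ℝ → E} {c d : ℝ}
    (h : ∀ a b, c < a → b < d → AEStronglyMeasurable g (volume.restrict (Icc a b))) :
    AEStronglyMeasurable g (volume.restrict (Ioo c d)) := by
  have hU : AEStronglyMeasurable g (volume.restrict
      (⋃ n : ℕ, Icc (c + 1 / ((n : ℝ) + 1)) (d - 1 / ((n : ℝ) + 1)))) := by
    rw [aestronglyMeasurable_iUnion_iff]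
    intro n
    have : 0 < 1 / ((n : ℝ) + 1) := by positivity
    exact h _ _ (by linarith) (by linarith)
  refine hU.mono_set fun t ht => ?_
  obtain ⟨n, hn⟩ := exists_nat_one_div_lt (lt_min (sub_pos.2 ht.1) (sub_pos.2 ht.2))
  rw [lt_min_iff] at hn
  exact mem_iUnion.2 ⟨n, by linarith [hn.1], by linarith [hn.2]⟩

lemma tendsto_zero_of_rpow_le {α : Type*} {l : Filter α} {A B : α → ℝ≥0∞} {p : ℝ} (hp : 0 < p)
    (hB : Tendsto B l (𝓝 0)) (h : ∀ᶠ x in l, A x ^ p ≤ B x) : Tendsto A l (𝓝 0) := by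
  have h1 := ((ENNReal.continuous_rpow_const (y := p⁻¹)).tendsto 0).comp hB
  rw [ENNReal.zero_rpow_of_pos (inv_pos.2 hp)] at h1
  refine tendsto_of_tendsto_of_tendsto_of_le_of_le' tendsto_const_nhds h1
    (Eventually.of_forall fun _ => bot_le) ?_
  filter_upwards [h] with x hx
  exact (ENNReal.le_rpow_inv_iff hp).2 hx

end times

/-! ### Mollifications and translations in parabolic Newton-Sobolev spaces -/

section parabolic

variable {X : Type*} [MetricSpace X] [MeasurableSpace X] {p : ℝ} [hp : Fact (1 ≤ p)]
  {μ : Measure X} {Ω U V : Set X} {τ : ℝ} {f : ℝ → X → ℝ}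

lemma MemParabolicLoc.ae_memNewtonLoc (hf : MemParabolicLoc p μ Ω τ f) :
    ∀ᵐ t, t ∈ Ioo 0 τ → MemNewtonLoc p μ Ω (f t) :=
  (ae_restrict_iff' measurableSet_Ioo).1 hf.1

/-- Truncation to [a,b] gives a strongly measurable function in L^p of the whole line, to which the
translation and mollification results apply. -/
lemma MemParabolicLoc.exists_representative (hf : MemParabolicLoc p μ Ω τ f) (hU : IsOpen U)
    (hUΩ : WellInside U Ω) {a b : ℝ} (ha : 0 < a) (hb : b < τ) :
    ∃ ψ : ℝ → Newton p μ U, StronglyMeasurable ψ ∧ MemLp ψ (ENNReal.ofReal p) volume ∧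
      ∀ᵐ t, t ∈ Icc a b → ψ t = toNewton p μ U (f t) := by
  have h := hf.2 U hU hUΩ a b ha hb
  refine ⟨(Icc a b).indicator (h.1.mk _), h.1.stronglyMeasurable_mk.indicator measurableSet_Icc,
    ?_, ?_⟩
  · rw [memLp_indicator_iff_restrict measurableSet_Icc]
    exact (memLp_congr_ae h.1.ae_eq_mk).1 h
  · have := (ae_restrict_iff' measurableSet_Icc).1 h.1.ae_eq_mk
    filter_upwards [this] with t ht htI
    rw [indicator_of_mem htI, ht htI]

lemma MemParabolicLoc.aestronglyMeasurable (hf : MemParabolicLoc p μ Ω τ f) (hU : IsOpen U)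
    (hUΩ : WellInside U Ω) :
    AEStronglyMeasurable (fun t => toNewton p μ U (f t)) (volume.restrict (Ioo 0 τ)) :=
  aestronglyMeasurable_Ioo_of_Icc fun a b ha hb => (hf.2 U hU hUΩ a b ha hb).1

lemma ae_smul_comp_sub_eq {E : Type*} [NormedAddCommGroup E] [NormedSpace ℝ E] {φ ψ : ℝ → E}
    {a b t ε : ℝ} (hψ : ∀ᵐ t, t ∈ Icc a b → ψ t = φ t) (w : ℝ → ℝ) (hε : 0 < ε)
    (ha : a ≤ t - ε) (hb : t + ε ≤ b) :
    ∀ᵐ s, s ∈ uIoc (-ε) ε → w s • φ (t - s) = w s • ψ (t - s) := by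
  filter_upwards [ae_comp_sub_left hψ t] with s hs hsI
  rw [uIoc_of_le (by linarith)] at hsI
  rw [hs ⟨by linarith [hsI.2], by linarith [hsI.1]⟩]

lemma MemParabolicLoc.intervalIntegrable (hf : MemParabolicLoc p μ Ω τ f) (hU : IsOpen U)
    (hUΩ : WellInside U Ω) {w : ℝ → ℝ} (hw : Continuous w) {ε t : ℝ} (hε : 0 < ε)
    (ht : t ∈ Ioo ε (τ - ε)) :
    IntervalIntegrable (fun s => w s • toNewton p μ U (f (t - s))) volume (-ε) ε := by
  obtain ⟨ψ, -, hψ, hψf⟩ := hf.exists_representative hU hUΩ (a := t - ε) (b := t + ε)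
    (by linarith [ht.1]) (by linarith [ht.2])
  refine (MemLp.intervalIntegrable_smul_comp_sub hp.out hψ hw t (-ε) ε).congr_ae ?_
  rw [EventuallyEq, ae_restrict_iff' measurableSet_uIoc]
  filter_upwards [ae_smul_comp_sub_eq hψf w hε le_rfl le_rfl] with s hs hsI using (hs hsI).symm

/-- The Bochner integral commutes with the continuous linear restriction map; this is the
compatibility needed for gluing mollifications over an exhaustion. -/
lemma MemParabolicLoc.newtonRestrict_integral [BorelSpace X]
    (hf : MemParabolicLoc p μ Ω τ f) (hU : IsOpen U)
    (hUΩ : WellInside U Ω) (hV : IsOpen V) (hVU : V ⊆ U) {w : ℝ → ℝ} (hw : Continuous w) {ε t : ℝ}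
    (hε : 0 < ε) (ht : t ∈ Ioo ε (τ - ε)) :
    newtonRestrict hVU (∫ s in (-ε)..ε, w s • toNewton p μ U (f (t - s))) =
      ∫ s in (-ε)..ε, w s • toNewton p μ V (f (t - s)) := by
  have := completeSpace_newton (p := p) (μ := μ) hU
  have := completeSpace_newton (p := p) (μ := μ) hV
  rw [← ContinuousLinearMap.intervalIntegral_comp_comm _
    (hf.intervalIntegrable hU hUΩ hw hε ht)]
  refine intervalIntegral.integral_congr_ae ?_
  filter_upwards [ae_comp_sub_left hf.ae_memNewtonLoc t] with s hs hsI
  rw [uIoc_of_le (by linarith)] at hsI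
  have hmem := hs ⟨by linarith [hsI.2, ht.1], by linarith [hsI.1, ht.2]⟩ U hU hUΩ
  rw [map_smul, newtonRestrict_toNewton hVU hmem]

lemma MemParabolicLoc.exists_isTimeMollification [BorelSpace X]
    (hf : MemParabolicLoc p μ Ω τ f) {η : ℝ → ℝ}
    (hη : IsMollifier η) {ε : ℝ} (hε : 0 < ε) : ∃ F, IsTimeMollification p μ Ω τ η ε f F := by
  obtain ⟨U, hU⟩ := exists_isExhaustion Ω
  have hw := hη.continuous_rescale ε
  have key : ∀ t, ∃ v : X → ℝ, t ∈ Ioo ε (τ - ε) → MemNewtonLoc p μ Ω v ∧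
      ∀ V : Set X, IsOpen V → WellInside V Ω → toNewton p μ V v =
        ∫ s in (-ε)..ε, (ε⁻¹ * η (s / ε)) • toNewton p μ V (f (t - s)) := by
    intro t
    by_cases ht : t ∈ Ioo ε (τ - ε)
    swap
    · exact ⟨0, fun h => absurd h ht⟩
    obtain ⟨v, hv, hvU⟩ := hU.exists_memNewtonLoc
      (fun n => ∫ s in (-ε)..ε, (ε⁻¹ * η (s / ε)) • toNewton p μ (U n) (f (t - s)))
      (fun n => hf.newtonRestrict_integral (hU.isOpen (n + 1)) (hU.wellInside (n + 1)) (hU.isOpen n)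
        (hU.mono n.le_succ) hw hε ht)
    refine ⟨v, fun _ => ⟨hv, fun V hV hVΩ => ?_⟩⟩
    obtain ⟨n, hn⟩ := hU.cofinal V hVΩ
    rw [← newtonRestrict_toNewton hn (hv _ (hU.isOpen n) (hU.wellInside n)), hvU,
      hf.newtonRestrict_integral (hU.isOpen n) (hU.wellInside n) hV hn hw hε ht]
  choose F hF using key
  exact ⟨F, fun t ht => hF t ht⟩

lemma IsTimeMollification.toNewton_eq {η : ℝ → ℝ} {ε : ℝ}
    {F : ℝ → X → ℝ} (hF : IsTimeMollification p μ Ω τ η ε f F) (hε : 0 < ε) (hU : IsOpen U)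
    (hUΩ : WellInside U Ω) {a b t : ℝ} {ψ : ℝ → Newton p μ U}
    (hψ : ∀ᵐ t, t ∈ Icc a b → ψ t = toNewton p μ U (f t)) (ht : t ∈ Ioo ε (τ - ε))
    (ha : a ≤ t - ε) (hb : t + ε ≤ b) :
    toNewton p μ U (F t) = ∫ s in (-ε)..ε, (ε⁻¹ * η (s / ε)) • ψ (t - s) := by
  rw [(hF t ht).2 U hU hUΩ]
  exact intervalIntegral.integral_congr_ae
    (ae_smul_comp_sub_eq hψ (fun s => ε⁻¹ * η (s / ε)) hε ha hb)

lemma IsTimeMollification.aestronglyMeasurable (hf : MemParabolicLoc p μ Ω τ f) {η : ℝ → ℝ}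
    (hη : IsMollifier η) {ε : ℝ} {F : ℝ → X → ℝ} (hF : IsTimeMollification p μ Ω τ η ε f F)
    (hε : 0 < ε) (hU : IsOpen U) (hUΩ : WellInside U Ω) :
    AEStronglyMeasurable (fun t => toNewton p μ U (F t)) (volume.restrict (Ioo ε (τ - ε))) := by
  refine aestronglyMeasurable_Ioo_of_Icc fun a b ha hb => ?_
  obtain ⟨ψ, hψs, -, hψf⟩ := hf.exists_representative hU hUΩ (a := a - ε) (b := b + ε)
    (by linarith) (by linarith)
  refine ⟨_, stronglyMeasurable_intervalIntegral_smul_comp_sub hψs (hη.continuous_rescale ε)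
    (-ε) ε, (ae_restrict_iff' measurableSet_Icc).2 (ae_of_all _ fun t ht => ?_)⟩
  exact hF.toNewton_eq hε hU hUΩ hψf ⟨by linarith [ht.1], by linarith [ht.2]⟩
    (by linarith [ht.1]) (by linarith [ht.2])

lemma MemNewtonLoc.sub {u v : X → ℝ} (hu : MemNewtonLoc p μ Ω u) (hv : MemNewtonLoc p μ Ω v) :
    MemNewtonLoc p μ Ω (u - v) := fun U hU hUΩ => (hu U hU hUΩ).sub hp.out (hv U hU hUΩ)

lemma aestronglyMeasurable_toNewton_sub {J : Set ℝ} {h k : ℝ → X → ℝ} (hU : IsOpen U)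
    (hUΩ : WellInside U Ω) (hh : ∀ᵐ t ∂(volume.restrict J), MemNewtonLoc p μ Ω (h t))
    (hk : ∀ᵐ t ∂(volume.restrict J), MemNewtonLoc p μ Ω (k t))
    (hhm : AEStronglyMeasurable (fun t => toNewton p μ U (h t)) (volume.restrict J))
    (hkm : AEStronglyMeasurable (fun t => toNewton p μ U (k t)) (volume.restrict J)) :
    AEStronglyMeasurable (fun t => toNewton p μ U (h t - k t)) (volume.restrict J) := by
  refine (hhm.sub hkm).congr ?_
  filter_upwards [hh, hk] with t ht ht'
  exact (toNewton_sub (ht U hU hUΩ) (ht' U hU hUΩ)).symm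

lemma IsTimeMollification.exists_isParabolicMinUpperGradient [BorelSpace X]
    (hf : MemParabolicLoc p μ Ω τ f)
    {η : ℝ → ℝ} (hη : IsMollifier η) {ε : ℝ} {F : ℝ → X → ℝ}
    (hF : IsTimeMollification p μ Ω τ η ε f F) (hε : 0 < ε) :
    ∃ G, IsParabolicMinUpperGradient p μ Ω (Ioo ε (τ - ε)) (fun t => F t - f t) G := by
  obtain ⟨U, hU⟩ := exists_isExhaustion Ω
  have hsub : Ioo ε (τ - ε) ⊆ Ioo 0 τ := Ioo_subset_Ioo hε.le (by linarith)
  have h1 : ∀ᵐ t ∂(volume.restrict (Ioo ε (τ - ε))), MemNewtonLoc p μ Ω (F t) :=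
    (ae_restrict_iff' measurableSet_Ioo).2 (ae_of_all _ fun t ht => (hF t ht).1)
  have h2 : ∀ᵐ t ∂(volume.restrict (Ioo ε (τ - ε))), MemNewtonLoc p μ Ω (f t) :=
    ae_restrict_of_ae_restrict_of_subset hsub hf.1
  refine hU.exists_isParabolicMinUpperGradient ?_ fun n => ?_
  · filter_upwards [h1, h2] with t ht ht' using ht.sub ht'
  · exact aestronglyMeasurable_toNewton_sub (hU.isOpen n) (hU.wellInside n) h1 h2
      (hF.aestronglyMeasurable hf hη hε (hU.isOpen n) (hU.wellInside n))
      ((hf.aestronglyMeasurable (hU.isOpen n) (hU.wellInside n)).mono_set hsub)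

lemma MemParabolicLoc.exists_isParabolicMinUpperGradient_translation
    [BorelSpace X] (hf : MemParabolicLoc p μ Ω τ f) (s : ℝ) :
    ∃ G, IsParabolicMinUpperGradient p μ Ω (Ioo 0 τ ∩ Ioo s (τ + s))
      (fun t => f (t - s) - f t) G := by
  obtain ⟨U, hU⟩ := exists_isExhaustion Ω
  have h1 : ∀ᵐ t ∂(volume.restrict (Ioo 0 τ ∩ Ioo s (τ + s))), MemNewtonLoc p μ Ω (f (t - s)) := by
    rw [ae_restrict_iff' (measurableSet_Ioo.inter measurableSet_Ioo)]
    filter_upwards [ae_comp_sub_right hf.ae_memNewtonLoc s] with t ht htJ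
    exact ht ⟨by linarith [htJ.2.1], by linarith [htJ.2.2]⟩
  have h2 : ∀ᵐ t ∂(volume.restrict (Ioo 0 τ ∩ Ioo s (τ + s))), MemNewtonLoc p μ Ω (f t) :=
    ae_restrict_of_ae_restrict_of_subset inter_subset_left hf.1
  refine hU.exists_isParabolicMinUpperGradient ?_ fun n => ?_
  · filter_upwards [h1, h2] with t ht ht' using ht.sub ht'
  · refine aestronglyMeasurable_toNewton_sub (hU.isOpen n) (hU.wellInside n) h1 h2 ?_
      ((hf.aestronglyMeasurable (hU.isOpen n) (hU.wellInside n)).mono_set inter_subset_left)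
    have hmp := (measurePreserving_sub_right volume s).restrict_preimage
      (measurableSet_Ioo (a := (0 : ℝ)) (b := τ))
    rw [preimage_sub_const_Ioo, zero_add] at hmp
    exact ((hf.aestronglyMeasurable (hU.isOpen n) (hU.wellInside n)).comp_measurePreserving
      hmp).mono_set inter_subset_right

/-- The passage from gradients to norms: by Fubini each time slice contributes the Dirichlet
seminorm of `h t`, which is at most its N^{1,p}(U) norm. -/
lemma IsParabolicMinUpperGradient.eLpNorm_rpow_le [SFinite μ] {J : Set ℝ} {h : ℝ → X → ℝ}
    {G : X × ℝ → ℝ≥0∞} (hG : IsParabolicMinUpperGradient p μ Ω J h G) (hU : IsOpen U)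
    (hUΩ : WellInside U Ω) {I : Set ℝ} (hIJ : I ⊆ J) {K : Set (X × ℝ)} (hK : K ⊆ U ×ˢ I)
    {Φ : ℝ → ℝ≥0∞} (hΦ : ∀ᵐ t ∂(volume.restrict I), newtonENorm p μ U (h t) ≤ Φ t) :
    eLpNorm G (ENNReal.ofReal p) ((μ.prod volume).restrict K) ^ p ≤ ∫⁻ t in I, Φ t ^ p := by
  have hp0 : 0 < p := zero_lt_one.trans_le hp.out
  calc _ ≤ eLpNorm G (ENNReal.ofReal p) ((μ.prod volume).restrict (U ×ˢ I)) ^ p :=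
        ENNReal.rpow_le_rpow (eLpNorm_mono_measure _ (Measure.restrict_mono hK le_rfl)) hp0.le
    _ = ∫⁻ t in I, ∫⁻ x in U, G (x, t) ^ p ∂μ := by
        rw [eLpNorm_rpow_eq_lintegral hp0, ← Measure.prod_restrict,
          lintegral_prod_symm' _ (hG.1.pow_const p)]
    _ ≤ _ := by
        refine lintegral_mono_ae ?_
        filter_upwards [hΦ, ae_restrict_of_ae_restrict_of_subset hIJ hG.2] with t ht hGt
        rw [← eLpNorm_rpow_eq_lintegral hp0, (hGt U hU hUΩ).eLpNorm_eq hp.out]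
        exact ENNReal.rpow_le_rpow ((gradNorm_le_newtonENorm hp0 _).trans ht) hp0.le

lemma tendsto_eLpNorm_mollification_sub [BorelSpace X] [SFinite μ] (hf : MemParabolicLoc p μ Ω τ f)
    {η : ℝ → ℝ} (hη : IsMollifier η) {F : ℝ → ℝ → X → ℝ}
    (hF : ∀ ε > 0, IsTimeMollification p μ Ω τ η ε f (F ε)) {G : ℝ → X × ℝ → ℝ≥0∞}
    (hG : ∀ ε > 0, IsParabolicMinUpperGradient p μ Ω (Ioo ε (τ - ε)) (fun t => F ε t - f t) (G ε))
    {K : Set (X × ℝ)} (hK : WellInside K (Ω ×ˢ Ioo 0 τ)) :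
    Tendsto (fun ε => eLpNorm (G ε) (ENNReal.ofReal p) ((μ.prod volume).restrict K))
      (𝓝[>] 0) (𝓝 0) := by
  obtain ⟨U, a, b, hU, hUΩ, ha, hb, hKU⟩ := hK.exists_subset_prod
  have := completeSpace_newton (p := p) (μ := μ) hU
  -- The larger interval leaves margins a/2 and (τ - b)/2 around [a,b], so for smaller `ε` the
  -- mollification at times in [a,b] sees only values where `ψ` represents `f`.
  obtain ⟨ψ, hψs, hψ, hψf⟩ := hf.exists_representative hU hUΩ (a := a / 2) (b := (b + τ) / 2)
    (by linarith) (by linarith)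
  refine tendsto_zero_of_rpow_le (zero_lt_one.trans_le hp.out)
    (hη.tendsto_lintegral_mollify_sub hp.out hψs hψ) ?_
  filter_upwards [Ioo_mem_nhdsGT (lt_min (half_pos ha) (half_pos (sub_pos.2 hb)))] with ε hε
  have hε1 : ε < a / 2 := hε.2.trans_le (min_le_left _ _)
  have hε2 : ε < (τ - b) / 2 := hε.2.trans_le (min_le_right _ _)
  have hsub : Icc a b ⊆ Ioo ε (τ - ε) := fun t ht => ⟨by linarith [ht.1], by linarith [ht.2]⟩
  refine ((hG ε hε.1).eLpNorm_rpow_le hU hUΩ hsub hKU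
    (Φ := fun t => ‖(∫ s in (-ε)..ε, (ε⁻¹ * η (s / ε)) • ψ (t - s)) - ψ t‖ₑ) ?_).trans
    (setLIntegral_le_lintegral _ _)
  rw [ae_restrict_iff' measurableSet_Icc]
  filter_upwards [hψf, hf.ae_memNewtonLoc] with t htψ htf ht
  have ht' := hsub ht
  have hft := htf ⟨by linarith [ht.1], by linarith [ht.2]⟩ U hU hUΩ
  have hFt := (hF ε hε.1 t ht').1 U hU hUΩ
  rw [htψ ⟨by linarith [ht.1], by linarith [ht.2]⟩, ← (hF ε hε.1).toNewton_eq hε.1 hU hUΩ hψf ht'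
    (by linarith [ht.1]) (by linarith [ht.2]), ← toNewton_sub hFt hft,
    enorm_toNewton (hFt.sub hp.out hft)]

lemma tendsto_eLpNorm_translation_sub [SFinite μ] (hf : MemParabolicLoc p μ Ω τ f)
    {G : ℝ → X × ℝ → ℝ≥0∞}
    (hG : ∀ s, IsParabolicMinUpperGradient p μ Ω (Ioo 0 τ ∩ Ioo s (τ + s))
      (fun t => f (t - s) - f t) (G s))
    {K : Set (X × ℝ)} (hK : WellInside K (Ω ×ˢ Ioo 0 τ)) :
    Tendsto (fun s => eLpNorm (G s) (ENNReal.ofReal p) ((μ.prod volume).restrict K))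
      (𝓝 0) (𝓝 0) := by
  obtain ⟨U, a, b, hU, hUΩ, ha, hb, hKU⟩ := hK.exists_subset_prod
  obtain ⟨ψ, -, hψ, hψf⟩ := hf.exists_representative hU hUΩ (a := a / 2) (b := (b + τ) / 2)
    (by linarith) (by linarith)
  refine tendsto_zero_of_rpow_le (zero_lt_one.trans_le hp.out)
    (tendsto_lintegral_translation_sub hp.out hψ) ?_
  -- For such `s`, both `t` and `t - s` lie in the interval where `ψ` represents `f`, whenever `t`
  -- is in [a,b].
  filter_upwards [Metric.ball_mem_nhds (0 : ℝ)
    (lt_min (half_pos ha) (half_pos (sub_pos.2 hb)))] with s hs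
  rw [Metric.mem_ball, Real.dist_eq, sub_zero, lt_min_iff, abs_lt, abs_lt] at hs
  obtain ⟨⟨hs1, hs2⟩, hs3, hs4⟩ := hs
  have hsub : Icc a b ⊆ Ioo 0 τ ∩ Ioo s (τ + s) := fun t ht =>
    ⟨⟨by linarith [ht.1], by linarith [ht.2]⟩, by linarith [ht.1], by linarith [ht.2]⟩
  refine ((hG s).eLpNorm_rpow_le hU hUΩ hsub hKU (Φ := fun t => ‖ψ (t - s) - ψ t‖ₑ) ?_).trans
    (setLIntegral_le_lintegral _ _)
  rw [ae_restrict_iff' measurableSet_Icc]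
  filter_upwards [hψf, hf.ae_memNewtonLoc, ae_comp_sub_right hψf s,
    ae_comp_sub_right hf.ae_memNewtonLoc s] with t htψ htf htψs htfs ht
  have hft := htf ⟨by linarith [ht.1], by linarith [ht.2]⟩ U hU hUΩ
  have hfts := htfs ⟨by linarith [ht.1], by linarith [ht.2]⟩ U hU hUΩ
  rw [htψ ⟨by linarith [ht.1], by linarith [ht.2]⟩,
    htψs ⟨by linarith [ht.1], by linarith [ht.2]⟩, ← toNewton_sub hfts hft,
    enorm_toNewton (hfts.sub hp.out hft)]

end parabolic

end NewtonSobolev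

end

theorem mainTheorem1 {X : Type*} [MetricSpace X] [CompleteSpace X]
    [TopologicalSpace.SeparableSpace X] [MeasurableSpace X] [BorelSpace X]
    (μ : MeasureTheory.Measure X) [MeasureTheory.IsLocallyFiniteMeasure μ]
    (Ω : Set X) (hΩ : IsOpen Ω) (p : ℝ) [Fact (1 ≤ p)] (τ : ℝ) (hτ : 0 < τ)
    (η : ℝ → ℝ) (hη : NewtonSobolev.IsMollifier η)
    (f : ℝ → X → ℝ) (hf : NewtonSobolev.MemParabolicLoc p μ Ω τ f) :
    -- the time mollifications `F ε` of `f` exist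
    (∃ F : ℝ → ℝ → X → ℝ, ∀ ε > 0, NewtonSobolev.IsTimeMollification p μ Ω τ η ε f (F ε)) ∧
    -- the minimal upper gradients `G ε` of `F ε - f` exist and tend to `0` in `L^p_loc`
    (∀ F : ℝ → ℝ → X → ℝ,
      (∀ ε > 0, NewtonSobolev.IsTimeMollification p μ Ω τ η ε f (F ε)) →
      (∃ G : ℝ → X × ℝ → ℝ≥0∞, ∀ ε > 0,
        NewtonSobolev.IsParabolicMinUpperGradient p μ Ω (Ioo ε (τ - ε))
          (fun t => F ε t - f t) (G ε)) ∧
      ∀ G : ℝ → X × ℝ → ℝ≥0∞,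
        (∀ ε > 0, NewtonSobolev.IsParabolicMinUpperGradient p μ Ω (Ioo ε (τ - ε))
          (fun t => F ε t - f t) (G ε)) →
        ∀ K : Set (X × ℝ), NewtonSobolev.WellInside K (Ω ×ˢ Ioo 0 τ) →
          Tendsto (fun ε => eLpNorm (G ε) (ENNReal.ofReal p) ((μ.prod volume).restrict K))
            (𝓝[>] 0) (𝓝 0)) ∧
    -- the minimal upper gradients `G s` of `f(t - s) - f(t)` exist and tend to `0` in `L^p_loc`,
    -- uniformly with respect to the set `J` of times over which the norm is taken
    (∃ G : ℝ → X × ℝ → ℝ≥0∞, ∀ s,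
      NewtonSobolev.IsParabolicMinUpperGradient p μ Ω (Ioo 0 τ ∩ Ioo s (τ + s))
        (fun t => f (t - s) - f t) (G s)) ∧
    (∀ G : ℝ → X × ℝ → ℝ≥0∞,
      (∀ s, NewtonSobolev.IsParabolicMinUpperGradient p μ Ω (Ioo 0 τ ∩ Ioo s (τ + s))
        (fun t => f (t - s) - f t) (G s)) →
      ∀ K : Set (X × ℝ), NewtonSobolev.WellInside K (Ω ×ˢ Ioo 0 τ) →
        ∀ δ : ℝ≥0∞, 0 < δ → ∃ σ : ℝ, 0 < σ ∧ ∀ s : ℝ, |s| < σ → ∀ J : Set ℝ,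
          eLpNorm (G s) (ENNReal.ofReal p) ((μ.prod volume).restrict (K ∩ univ ×ˢ J)) ≤ δ) := by
  -- Second countability makes the locally finite measure σ-finite, as Fubini requires.
  have : SecondCountableTopology X := UniformSpace.secondCountable_of_separable X
  refine ⟨?_, fun F hF => ⟨?_, fun G hG K hK => ?_⟩, ?_, fun G hG K hK δ hδ => ?_⟩
  · choose! F hF using fun (ε : ℝ) (hε : 0 < ε) => hf.exists_isTimeMollification hη hε
    exact ⟨F, hF⟩
  · choose! G hG using fun (ε : ℝ) (hε : 0 < ε) =>
      (hF ε hε).exists_isParabolicMinUpperGradient hf hη hε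
    exact ⟨G, hG⟩
  · exact NewtonSobolev.tendsto_eLpNorm_mollification_sub hf hη hF hG hK
  · choose G hG using hf.exists_isParabolicMinUpperGradient_translation
    exact ⟨G, hG⟩
  · have h := ENNReal.tendsto_nhds_zero.1
      (NewtonSobolev.tendsto_eLpNorm_translation_sub hf hG hK) δ hδ
    obtain ⟨σ, hσ, hball⟩ := Metric.eventually_nhds_iff.1 h
    -- Uniformity in `J` is monotonicity: the norm over all of `K` is already small.
    refine ⟨σ, hσ, fun s hs J => le_trans (eLpNorm_mono_measure _ ?_) (hball (by simpa using hs))⟩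
    exact Measure.restrict_mono inter_subset_left le_rfl
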